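/- \textbf{Setting.} All vector spaces are over $\mathbb C$, and signs follow the Koszul rule. For a graded vector space $A$ let $SA$ be its graded symmetric (cofree nilpotent cocommutative) coalgebra, spanned by the products $a_1\odot\cdots\odot a_n$, $n\ge 1$. If $A$ is a graded commutative associative algebra, let $\varphi:SA\to SA$ be the coalgebra automorphism with components $a_1\odot\cdots\odot a_n\mapsto a_1\cdots a_n$. A differential $d$ on $A$ extends to a coderivation of $SA$, and $d^\varphi=\varphi^{-1}d\varphi$. An $L_\infty$ morphism $(\mathbb C,0)\to(A,d^\varphi)$ is a degree zero coalgebra map $X:S\mathbb C\to SA$ with $d^\varphi X=0$; it is determined by its components $X_n(1\odot\cdots\odot1)\in A$. An $L_\infty$ homotopy between two such morphisms $X,Y$ is a degree zero coalgebra map $H:S\mathbb C\to SA\otimes\mathbb C[t,dt]$ (coalgebras over $\mathbb C[t,dt]$ on the target side, so that $H$ is determined by its components $H_n(1\odot\cdots\odot 1)\in A\otimes\mathbb C[t,dt]$, of total degree zero) with $(d^\varphi\otimes1+1\otimes d_{dR})H=0$, whose evaluation at $t=0$, $dt=0$ is $X$ and whose evaluation at $t=1$, $dt=0$ is $Y$.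 The homotopy Gaussian is $V=\mathbb C[x,\eta]$ with $|x|=0$, $|\eta|=-1$, $\eta^2=0$, differential $d(p+q\eta)=q'-xq$ and expectation $E(p+q\eta)=\int_{\mathbb R}p\,e^{-x^2/2}dx\big/\int_{\mathbb R}e^{-x^2/2}dx$. The cumulants of an $L_\infty$ morphism $X:(\mathbb C,0)\to(V,d^\varphi)$ are the components $\kappa_n:S^n\mathbb C\to\mathbb C$ of the composition of $X$ with $\varphi^{-1}E\varphi:SV\to S\mathbb C$. Put $y_n=-\eta\sum_{j=1}^{\lfloor (n+1)/2\rfloor}\frac{(n-1)!!}{(n+1-2j)!!}\,x^{n+1-2j}$ for $n\ge1$ (so that $dy_n=x^n-E(x^n)$). For a polynomial $r(x)=\sum_i a_ix^i$ with $E(r)=0$ put $h(r)=\sum_{i\ge1}a_iy_i$ (so that $d(h(r))=r$). \textbf{Proposition.} Let $p,q\in\mathbb C[x]$ and let $X$, $Y$ be the ordinary random variables in the homotopy Gaussian with $X(1)=p(x)$, $Y(1)=q(x)$, that is, the $L_\infty$ morphisms $(\mathbb C,0)\to(V,d^\varphi)$ with these first components and with all higher components zero. Suppose that $X$ and $Y$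 have the same cumulants $\kappa_n$ for all $n\ge1$. For $n\ge1$ put, in $V\otimes\mathbb C[t,dt]$, \[\Lambda_n=p^n+t(q^n-p^n)+h(p^n-q^n)\,dt,\qquad H_n(1\odot\cdots\odot1)=\sum_{k=1}^n\ \sum_{\{B_1,\dots,B_k\}}(-1)^{k-1}(k-1)!\;\Lambda_{|B_1|}\cdots\Lambda_{|B_k|},\] where the inner sum runs over the partitions of the set $\{1,\dots,n\}$ into $k$ nonempty blocks. Then the $H_n$ are the components of an $L_\infty$ homotopy from $(\mathbb C,0)$ to $(V,d^\varphi)$ between $X$ and $Y$. -/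

import Mathlib

open scoped TensorProduct DirectSum Polynomial Nat

set_option linter.unusedSectionVars false

noncomputable section

namespace HomotopyProbability

section GradedSymmetric

variable {M : Type} [AddCommGroup M] [Module ℂ M] (ℳ : ℤ → Submodule ℂ M)

/-! ### The graded symmetric algebra `S M` of a graded vector space `M`

`S M` is the quotient of the tensor algebra by `a ⊗ b = (-1)^{|a||b|} b ⊗ a`; its product is `⊙`.
Its part of word length at least one, with the unshuffle coproduct, is the cofree nilpotent
commutative coalgebra on `M`. -/

/-- The relation `a ⊗ b = (-1)^{|a||b|} b ⊗ a` for homogeneous `a`, `b`. -/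
inductive SymRel : TensorAlgebra ℂ M → TensorAlgebra ℂ M → Prop
  | swap {i j : ℤ} {a b : M} (ha : a ∈ ℳ i) (hb : b ∈ ℳ j) :
      SymRel (TensorAlgebra.ι ℂ a * TensorAlgebra.ι ℂ b)
        ((-1 : ℂ) ^ (i * j) • (TensorAlgebra.ι ℂ b * TensorAlgebra.ι ℂ a))

/-- The graded symmetric algebra `S M`, spanned by the products `a₁ ⊙ ⋯ ⊙ aₙ`. -/
def Sym : Type := RingQuot (SymRel ℳ)

namespace Sym

instance : Ring (Sym ℳ) := inferInstanceAs (Ring (RingQuot (SymRel ℳ)))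
instance : Algebra ℂ (Sym ℳ) := inferInstanceAs (Algebra ℂ (RingQuot (SymRel ℳ)))

/-- The quotient map from the tensor algebra. -/
def mk : TensorAlgebra ℂ M →ₐ[ℂ] Sym ℳ := RingQuot.mkAlgHom ℂ (SymRel ℳ)

/-- The inclusion of the generators `M = S¹ M → S M`. -/
def ι : M →ₗ[ℂ] Sym ℳ := (mk ℳ).toLinearMap ∘ₗ TensorAlgebra.ι ℂ

variable {ℳ} in
theorem ι_swap {i j : ℤ} {a b : M} (ha : a ∈ ℳ i) (hb : b ∈ ℳ j) :
    ι ℳ a * ι ℳ b = (-1 : ℂ) ^ (i * j) • (ι ℳ b * ι ℳ a) := by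
  have h : mk ℳ _ = mk ℳ _ := RingQuot.mkAlgHom_rel ℂ (SymRel.swap ha hb)
  simp only [map_smul, map_mul] at h
  exact h

/-- The universal property of `S M`. -/
def lift {A : Type} [Semiring A] [Algebra ℂ A] (f : M →ₗ[ℂ] A)
    (hf : ∀ (i j : ℤ) (a b : M), a ∈ ℳ i → b ∈ ℳ j →
      f a * f b = (-1 : ℂ) ^ (i * j) • (f b * f a)) : Sym ℳ →ₐ[ℂ] A :=
  RingQuot.liftAlgHom ℂ ⟨TensorAlgebra.lift ℂ f, by
    rintro _ _ ⟨ha, hb⟩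
    simpa using hf _ _ _ _ ha hb⟩

variable {ℳ} in
@[simp]
theorem lift_ι {A : Type} [Semiring A] [Algebra ℂ A] (f : M →ₗ[ℂ] A)
    (hf : ∀ (i j : ℤ) (a b : M), a ∈ ℳ i → b ∈ ℳ j →
      f a * f b = (-1 : ℂ) ^ (i * j) • (f b * f a)) (a : M) : lift ℳ f hf (ι ℳ a) = f a := by
  exact (RingQuot.liftAlgHom_mkAlgHom_apply ℂ _ _ _).trans (TensorAlgebra.lift_ι_apply f a)

variable {ℳ} in
theorem hom_ext {A : Type} [Semiring A] [Algebra ℂ A] {f g : Sym ℳ →ₐ[ℂ] A}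
    (h : ∀ a, f (ι ℳ a) = g (ι ℳ a)) : f = g := by
  apply RingQuot.ringQuot_ext'
  apply TensorAlgebra.hom_ext
  ext a
  exact h a

variable {ℳ} in
theorem induction {C : Sym ℳ → Prop} (one : C 1) (smul : ∀ (c : ℂ) w, C w → C (c • w))
    (add : ∀ u v, C u → C v → C (u + v)) (mul : ∀ a w, C w → C (ι ℳ a * w)) (w : Sym ℳ) : C w := by
  obtain ⟨t, rfl⟩ : ∃ t, mk ℳ t = w := RingQuot.mkAlgHom_surjective ℂ (SymRel ℳ) w
  suffices h : ∀ t : TensorAlgebra ℂ M, ∀ w, C w → C (mk ℳ t * w) by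
    simpa using h t 1 one
  intro t
  induction t using TensorAlgebra.induction with
  | algebraMap r => intro w hw; simpa [Algebra.algebraMap_eq_smul_one] using smul r w hw
  | ι a => intro w hw; exact mul a w hw
  | mul s t hs ht => intro w hw; rw [map_mul, mul_assoc]; exact hs _ (ht _ hw)
  | add s t hs ht => intro w hw; rw [map_add, add_mul]; exact add _ _ (hs _ hw) (ht _ hw)

/-- The part of total degree `n`: spanned by `a₁ ⊙ ⋯ ⊙ a_k` with `aᵢ` homogeneous and
`|a₁| + ⋯ + |a_k| = n`. -/
def grading (n : ℤ) : Submodule ℂ (Sym ℳ) :=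
  Submodule.span ℂ {w | ∃ l : List (Σ i, ℳ i),
    (l.map Sigma.fst).sum = n ∧ w = (l.map fun a => ι ℳ (a.2 : M)).prod}

variable {ℳ} in
theorem ι_mem {i : ℤ} {a : M} (ha : a ∈ ℳ i) : ι ℳ a ∈ grading ℳ i :=
  Submodule.subset_span ⟨[⟨i, a, ha⟩], by simp, by simp⟩

instance : SetLike.GradedMonoid (grading ℳ) where
  one_mem := Submodule.subset_span ⟨[], by simp, by simp⟩
  mul_mem := by
    intro i j x y hx hy
    have : grading ℳ i * grading ℳ j ≤ grading ℳ (i + j) := by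
      rw [grading, grading, Submodule.span_mul_span]
      refine Submodule.span_le.2 ?_
      rintro _ ⟨_, ⟨l, hl, rfl⟩, _, ⟨m, hm, rfl⟩, rfl⟩
      exact Submodule.subset_span ⟨l ++ m, by simp [hl, hm], by simp⟩
    exact this (Submodule.mul_mem_mul hx hy)

variable [DirectSum.Decomposition ℳ]

/-- The inclusion of the generators of degree `i`, with values in the part of total degree `i`. -/
def gradeι (i : ℤ) : ℳ i →ₗ[ℂ] grading ℳ i :=
  ((ι ℳ) ∘ₗ (ℳ i).subtype).codRestrict (grading ℳ i) fun a => ι_mem a.2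

/-- The generators, with values in the external direct sum of the graded pieces. -/
def toGradedι : M →ₗ[ℂ] ⨁ i, grading ℳ i :=
  DirectSum.toModule ℂ ℤ _ (fun i => DirectSum.lof ℂ ℤ (fun i => grading ℳ i) i ∘ₗ gradeι ℳ i) ∘ₗ
    (DirectSum.decomposeLinearEquiv ℳ).toLinearMap

variable {ℳ} in
theorem toGradedι_apply {i : ℤ} {a : M} (ha : a ∈ ℳ i) :
    toGradedι ℳ a = DirectSum.of (fun i => grading ℳ i) i ⟨ι ℳ a, ι_mem ha⟩ := by
  simp only [toGradedι, LinearMap.comp_apply, LinearEquiv.coe_coe,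
    DirectSum.decomposeLinearEquiv_apply]
  rw [DirectSum.decompose_of_mem ℳ ha, ← DirectSum.lof_eq_of ℂ, DirectSum.toModule_lof]
  rfl

theorem toGradedι_swap (i j : ℤ) (a b : M) (ha : a ∈ ℳ i) (hb : b ∈ ℳ j) :
    toGradedι ℳ a * toGradedι ℳ b = (-1 : ℂ) ^ (i * j) • (toGradedι ℳ b * toGradedι ℳ a) := by
  rw [toGradedι_apply ha, toGradedι_apply hb, DirectSum.of_mul_of, DirectSum.of_mul_of]
  rw [← DirectSum.lof_eq_of ℂ, ← DirectSum.lof_eq_of ℂ, ← map_smul,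
    DirectSum.lof_eq_of ℂ, DirectSum.lof_eq_of ℂ]
  apply DirectSum.of_eq_of_gradedMonoid_eq
  refine Sigma.subtype_ext (add_comm i j) ?_
  exact ι_swap ha hb

/-- The decomposition of `S M` into its graded pieces. -/
def toGraded : Sym ℳ →ₐ[ℂ] ⨁ i, grading ℳ i :=
  lift ℳ (toGradedι ℳ) (toGradedι_swap ℳ)

instance : GradedAlgebra (grading ℳ) :=
  GradedAlgebra.ofAlgHom (grading ℳ) (toGraded ℳ)
    (by
      apply hom_ext
      intro a
      simp only [AlgHom.comp_apply, AlgHom.id_apply]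
      induction a using DirectSum.Decomposition.inductionOn ℳ with
      | zero => simp
      | homogeneous a => simp [toGraded, toGradedι_apply a.2]
      | add a b ha hb => simp [ha, hb])
    (by
      rintro i ⟨x, hx⟩
      simp only
      induction hx using Submodule.span_induction with
      | zero => simp; exact (map_zero _).symm
      | add x y hx hy ihx ihy => 
        rw [map_add, ihx, ihy, ← map_add]; rfl
      | smul c x hx ih =>
        rw [map_smul, ih, ← DirectSum.lof_eq_of ℂ, ← map_smul]; rfl
      | mem x hx =>
        obtain ⟨l, rfl, rfl⟩ := hx
        induction l with
        | nil => simp; rfl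
        | cons a l ih =>
          simp only [List.map_cons, List.prod_cons, map_mul, ih]
          rw [toGraded, lift_ι, toGradedι_apply a.2.2, DirectSum.of_mul_of]
          rfl)


end Sym

variable [DirectSum.Decomposition ℳ]

/-- The linear map `a ↦ (-1)^{j|a|} a`. -/
def signTwist (j : ℤ) : M →ₗ[ℂ] M :=
  DirectSum.toModule ℂ ℤ M (fun i => (-1 : ℂ) ^ (i * j) • (ℳ i).subtype) ∘ₗ
    (DirectSum.decomposeLinearEquiv ℳ).toLinearMap

variable {ℳ} in
theorem signTwist_apply (j : ℤ) {i : ℤ} {a : M} (ha : a ∈ ℳ i) :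
    signTwist ℳ j a = (-1 : ℂ) ^ (i * j) • a := by
  simp only [signTwist, LinearMap.comp_apply, LinearEquiv.coe_coe,
    DirectSum.decomposeLinearEquiv_apply]
  rw [DirectSum.decompose_of_mem ℳ ha, ← DirectSum.lof_eq_of ℂ, DirectSum.toModule_lof]
  rfl

namespace Sym

theorem hom_induction {C : Sym ℳ → Prop} (one : C 1) (smul : ∀ (c : ℂ) w, C w → C (c • w))
    (add : ∀ u v, C u → C v → C (u + v))
    (mul : ∀ (i : ℤ) (a : M) w, a ∈ ℳ i → C w → C (ι ℳ a * w)) (w : Sym ℳ) : C w := by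
  refine induction one smul add (fun a w hw => ?_) w
  induction a using DirectSum.Decomposition.inductionOn ℳ with
  | zero => simpa using smul 0 1 one
  | homogeneous a => exact mul _ _ _ a.2 hw
  | add a b ha hb => rw [map_add, add_mul]; exact add _ _ ha hb

/-- The matrix with rows `(a, 0)` and `(f a, (-1)^{j|a|} a)`; an algebra map into such matrices has a
graded derivation of degree `j` as its lower left entry. -/
def derivGen (f : M →ₗ[ℂ] M) (j : ℤ) : M →ₗ[ℂ] Matrix (Fin 2) (Fin 2) (Sym ℳ) where
  toFun a := !![ι ℳ a, 0; ι ℳ (f a), ι ℳ (signTwist ℳ j a)]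
  map_add' a b := by ext p q; fin_cases p <;> fin_cases q <;> simp
  map_smul' c a := by ext p q; fin_cases p <;> fin_cases q <;> simp

variable {ℳ} in
theorem derivGen_swap {f : M →ₗ[ℂ] M} {j : ℤ} (hf : ∀ i, ∀ a ∈ ℳ i, f a ∈ ℳ (i + j))
    (k l : ℤ) (a b : M) (ha : a ∈ ℳ k) (hb : b ∈ ℳ l) :
    derivGen ℳ f j a * derivGen ℳ f j b =
      (-1 : ℂ) ^ (k * l) • (derivGen ℳ f j b * derivGen ℳ f j a) := by
  have h1 := ι_swap ha hb
  have h2 := ι_swap (hf k a ha) hb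
  have h3 := ι_swap ha (hf l b hb)
  have hk : (-1 : ℂ) ^ (k * l) * (-1 : ℂ) ^ (l * j) = (-1 : ℂ) ^ (k * l + l * j) :=
    (zpow_add₀ (by norm_num) _ _).symm
  have h4 : (-1 : ℂ) ^ (k * j) * (-1 : ℂ) ^ (k * (l + j)) = (-1 : ℂ) ^ (k * l) := by
    rw [← zpow_add₀ (by norm_num), show k * j + k * (l + j) = k * l + (k * j + k * j) by ring,
      zpow_add₀ (by norm_num), Even.neg_one_zpow ⟨k * j, rfl⟩, mul_one]
  ext p q
  fin_cases p <;> fin_cases q <;>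
    simp [derivGen, Matrix.mul_apply, Fin.sum_univ_two, signTwist_apply j ha, signTwist_apply j hb,
      smul_smul]
  · exact h1
  · rw [h2, h3, smul_smul, h4, hk, add_comm]
    congr 3
    ring_nf
  · rw [h1, smul_smul]
    congr 1
    ring

variable {ℳ} in
/-- The graded (co)derivation of `S M` of degree `j` that extends a linear map `f : M → M` of
degree `j`: `a₁ ⊙ ⋯ ⊙ aₙ ↦ ∑ᵢ (-1)^{j(|a₁| + ⋯ + |aᵢ₋₁|)} a₁ ⊙ ⋯ ⊙ f aᵢ ⊙ ⋯ ⊙ aₙ`. It is determined by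
`derivation_one` and `derivation_mul` below. -/
def derivation (f : M →ₗ[ℂ] M) (j : ℤ) (hf : ∀ i, ∀ a ∈ ℳ i, f a ∈ ℳ (i + j)) :
    Sym ℳ →ₗ[ℂ] Sym ℳ :=
  Matrix.entryLinearMap ℂ (Sym ℳ) (1 : Fin 2) (0 : Fin 2) ∘ₗ
    (lift ℳ (derivGen ℳ f j) (derivGen_swap hf)).toLinearMap

section
variable {ℳ}
variable (f : M →ₗ[ℂ] M) (j : ℤ) (hf : ∀ i, ∀ a ∈ ℳ i, f a ∈ ℳ (i + j))

theorem derivation_one : derivation f j hf 1 = 0 := by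
  simp [derivation]

theorem lift_derivGen_zero_zero (w : Sym ℳ) :
    (lift ℳ (derivGen ℳ f j) (derivGen_swap hf) w) 0 0 = w ∧
    (lift ℳ (derivGen ℳ f j) (derivGen_swap hf) w) 0 1 = 0 := by
  induction w using induction with
  | one => simp
  | smul c w hw => simp [hw]
  | add u v hu hv => simp [hu, hv]
  | mul a w hw => simp [Matrix.mul_apply, Fin.sum_univ_two, hw]; simp [derivGen]

theorem derivation_mul (a : M) (w : Sym ℳ) :
    derivation f j hf (ι ℳ a * w) =
      ι ℳ (f a) * w + ι ℳ (signTwist ℳ j a) * derivation f j hf w := by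
  have h := (lift_derivGen_zero_zero f j hf w).1
  simp only [derivation, LinearMap.comp_apply, AlgHom.toLinearMap_apply, map_mul, lift_ι,
    Matrix.entryLinearMap_apply, Matrix.mul_apply, Fin.sum_univ_two, h]
  simp [derivGen]

theorem derivation_add (g : M →ₗ[ℂ] M) (hg : ∀ i, ∀ a ∈ ℳ i, g a ∈ ℳ (i + j))
    (hfg : ∀ i, ∀ a ∈ ℳ i, (f + g) a ∈ ℳ (i + j)) :
    derivation (f + g) j hfg = derivation f j hf + derivation g j hg := by
  ext w
  induction w using induction with
  | one => simp [derivation_one]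
  | smul c w hw => simp only [map_smul, hw]
  | add u v hu hv => simp only [map_add, hu, hv]
  | mul a w hw =>
    simp only [derivation_mul, hw, LinearMap.add_apply, map_add, add_mul, mul_add]
    abel

theorem derivation_smul (c : ℂ) (hcf : ∀ i, ∀ a ∈ ℳ i, (c • f) a ∈ ℳ (i + j)) :
    derivation (c • f) j hcf = c • derivation f j hf := by
  ext w
  induction w using induction with
  | one => simp [derivation_one]
  | smul c w hw => simp only [map_smul, hw]
  | add u v hu hv => simp only [map_add, hu, hv]
  | mul a w hw =>
    simp only [derivation_mul, hw, LinearMap.smul_apply, map_smul, smul_add, smul_mul_assoc,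
      mul_smul_comm]

end

end Sym

section Cumulant

/-! ### The cumulant map `φ : S A → S A` of a graded commutative algebra `A` -/

/-- Graded commutativity: `a b = (-1)^{|a||b|} b a` for homogeneous `a`, `b`. -/
class GradedCommutative {A : Type} [Ring A] [Algebra ℂ A] (𝒜 : ℤ → Submodule ℂ A) : Prop where
  mul_swap : ∀ (i j : ℤ) (a b : A), a ∈ 𝒜 i → b ∈ 𝒜 j → a * b = (-1 : ℂ) ^ (i * j) • (b * a)

variable {A : Type} [Ring A] [Algebra ℂ A] (𝒜 : ℤ → Submodule ℂ A) [GradedAlgebra 𝒜]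

theorem mulLeft_degree {i : ℤ} {a : A} (ha : a ∈ 𝒜 i) (k : ℤ) (b : A) (hb : b ∈ 𝒜 k) :
    LinearMap.mulLeft ℂ a b ∈ 𝒜 (k + i) := by
  rw [add_comm]; exact SetLike.mul_mem_graded ha hb


/-- The operator `join` below, for `a` of degree `i`. -/
def joinHom (i : ℤ) : 𝒜 i →ₗ[ℂ] Module.End ℂ (Sym 𝒜) where
  toFun a := LinearMap.mulLeft ℂ (Sym.ι 𝒜 a) +
    Sym.derivation (LinearMap.mulLeft ℂ (a : A)) i (mulLeft_degree 𝒜 a.2)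
  map_add' a b := by
    have h : LinearMap.mulLeft ℂ ((a + b : 𝒜 i) : A) =
        LinearMap.mulLeft ℂ (a : A) + LinearMap.mulLeft ℂ (b : A) := by
      ext x; simp [add_mul]
    simp only [h]
    rw [Sym.derivation_add _ _ (mulLeft_degree 𝒜 a.2) _ (mulLeft_degree 𝒜 b.2)]
    ext w
    simp [add_mul]
    abel
  map_smul' c a := by
    have h : LinearMap.mulLeft ℂ ((c • a : 𝒜 i) : A) = c • LinearMap.mulLeft ℂ (a : A) := by
      ext x; simp
    simp only [h]
    rw [Sym.derivation_smul _ _ (mulLeft_degree 𝒜 a.2)]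
    ext w
    simp

/-- The operator `w ↦ a ⊙ w + ∑ᵢ ± b₁ ⊙ ⋯ ⊙ (a bᵢ) ⊙ ⋯ ⊙ bₙ` for `w = b₁ ⊙ ⋯ ⊙ bₙ`, with Koszul signs:
`a` becomes a new factor, or it is multiplied into one of the factors. -/
def join : A →ₗ[ℂ] Module.End ℂ (Sym 𝒜) :=
  DirectSum.toModule ℂ ℤ _ (joinHom 𝒜) ∘ₗ (DirectSum.decomposeLinearEquiv 𝒜).toLinearMap

variable {𝒜} in
theorem join_apply {i : ℤ} {a : A} (ha : a ∈ 𝒜 i) (w : Sym 𝒜) :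
    join 𝒜 a w = Sym.ι 𝒜 a * w +
      Sym.derivation (LinearMap.mulLeft ℂ a) i (mulLeft_degree 𝒜 ha) w := by
  simp only [join, LinearMap.comp_apply, LinearEquiv.coe_coe,
    DirectSum.decomposeLinearEquiv_apply]
  rw [DirectSum.decompose_of_mem 𝒜 ha, ← DirectSum.lof_eq_of ℂ, DirectSum.toModule_lof]
  rfl

/-- The filtration of `S A` by word length. -/
def filt : ℕ → Submodule ℂ (Sym 𝒜)
  | 0 => Submodule.span ℂ {1}
  | n + 1 => filt n ⊔
      Submodule.span ℂ {w | ∃ i, ∃ a ∈ 𝒜 i, ∃ u ∈ filt n, w = Sym.ι 𝒜 a * u}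

variable {𝒜} in
theorem ι_mul_mem_filt {i : ℤ} {a : A} (ha : a ∈ 𝒜 i) {n : ℕ} {u : Sym 𝒜} (hu : u ∈ filt 𝒜 n) :
    Sym.ι 𝒜 a * u ∈ filt 𝒜 (n + 1) :=
  Submodule.mem_sup_right (Submodule.subset_span ⟨i, a, ha, u, hu, rfl⟩)

theorem filt_mono : Monotone (filt 𝒜) := monotone_nat_of_le_succ fun _ => le_sup_left

theorem filt_le {n : ℕ} {P : Submodule ℂ (Sym 𝒜)} (h : filt 𝒜 n ≤ P)
    (h' : ∀ (i : ℤ) (a : A) (u : Sym 𝒜), a ∈ 𝒜 i → u ∈ filt 𝒜 n → Sym.ι 𝒜 a * u ∈ P) :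
    filt 𝒜 (n + 1) ≤ P :=
  sup_le h (Submodule.span_le.2 (by rintro _ ⟨i, a, ha, u, hu, rfl⟩; exact h' i a u ha hu))

theorem exists_mem_filt (w : Sym 𝒜) : ∃ n, w ∈ filt 𝒜 n := by
  induction w using Sym.hom_induction with
  | one => exact ⟨0, Submodule.mem_span_singleton_self 1⟩
  | smul c w hw => obtain ⟨n, hn⟩ := hw; exact ⟨n, Submodule.smul_mem _ _ hn⟩
  | add u v hu hv =>
    obtain ⟨n, hn⟩ := hu
    obtain ⟨m, hm⟩ := hv
    exact ⟨max n m, Submodule.add_mem _ (filt_mono 𝒜 (le_max_left _ _) hn)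
      (filt_mono 𝒜 (le_max_right _ _) hm)⟩
  | mul i a w ha hw => obtain ⟨n, hn⟩ := hw; exact ⟨n + 1, ι_mul_mem_filt ha hn⟩

theorem derivation_mem_filt {i : ℤ} {a : A} (ha : a ∈ 𝒜 i) (n : ℕ) :
    filt 𝒜 n ≤ (filt 𝒜 n).comap
      (Sym.derivation (LinearMap.mulLeft ℂ a) i (mulLeft_degree 𝒜 ha)) := by
  induction n with
  | zero =>
    refine Submodule.span_le.2 ?_
    rintro _ rfl
    simp [Sym.derivation_one]
  | succ n ih =>
    refine filt_le 𝒜 (fun u hu => filt_mono 𝒜 n.le_succ (ih hu)) fun k c u hc hu => ?_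
    rw [Submodule.mem_comap, Sym.derivation_mul, signTwist_apply _ hc, map_smul, smul_mul_assoc]
    exact Submodule.add_mem _ (ι_mul_mem_filt (SetLike.mul_mem_graded ha hc) hu)
      (Submodule.smul_mem _ _ (ι_mul_mem_filt hc (ih hu)))

variable [GradedCommutative 𝒜]

theorem derivation_mulLeft_swap {i j : ℤ} {a b : A} (ha : a ∈ 𝒜 i) (hb : b ∈ 𝒜 j) (w : Sym 𝒜) :
    Sym.derivation (LinearMap.mulLeft ℂ a) i (mulLeft_degree 𝒜 ha)
      (Sym.derivation (LinearMap.mulLeft ℂ b) j (mulLeft_degree 𝒜 hb) w) =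
    (-1 : ℂ) ^ (i * j) • Sym.derivation (LinearMap.mulLeft ℂ b) j (mulLeft_degree 𝒜 hb)
      (Sym.derivation (LinearMap.mulLeft ℂ a) i (mulLeft_degree 𝒜 ha) w) := by
  induction w using Sym.hom_induction with
  | one => simp [Sym.derivation_one]
  | smul c w hw => simp only [map_smul, hw]; rw [smul_comm]
  | add u v hu hv => simp only [map_add, hu, hv, smul_add]
  | mul k c w hc hw =>
    have h1 : (-1 : ℂ) ^ (i * j) * (-1 : ℂ) ^ ((j + k) * i) = (-1 : ℂ) ^ (k * i) := by
      rw [← zpow_add₀ (by norm_num), show i * j + (j + k) * i = k * i + (i * j + i * j) by ring,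
        zpow_add₀ (by norm_num), Even.neg_one_zpow ⟨i * j, rfl⟩, mul_one]
    have h2 : (-1 : ℂ) ^ (i * j) * (-1 : ℂ) ^ ((i + k) * j) = (-1 : ℂ) ^ (k * j) := by
      rw [← zpow_add₀ (by norm_num), show i * j + (i + k) * j = k * j + (i * j + i * j) by ring,
        zpow_add₀ (by norm_num), Even.neg_one_zpow ⟨i * j, rfl⟩, mul_one]
    have h3 : (-1 : ℂ) ^ ((j + k) * i) = (-1 : ℂ) ^ (i * j) * (-1 : ℂ) ^ (k * i) := by
      rw [← zpow_add₀ (by norm_num)]; ring_nf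
    have h4 : a * (b * c) = (-1 : ℂ) ^ (i * j) • (b * (a * c)) := by
      rw [← mul_assoc, GradedCommutative.mul_swap i j a b ha hb, smul_mul_assoc, mul_assoc]
    have hac := SetLike.mul_mem_graded ha hc
    have hbc := SetLike.mul_mem_graded hb hc
    simp only [Sym.derivation_mul, map_add, LinearMap.mulLeft_apply, signTwist_apply _ hc,
      signTwist_apply _ hac, signTwist_apply _ hbc, map_smul, smul_mul_assoc, h4, hw, smul_add,
      smul_smul, mul_smul_comm, h2]
    rw [h3, show (-1 : ℂ) ^ (i * j) * ((-1 : ℂ) ^ (k * i) * (-1 : ℂ) ^ (k * j)) =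
      (-1 : ℂ) ^ (k * j) * ((-1 : ℂ) ^ (i * j) * (-1 : ℂ) ^ (k * i)) by ring]
    abel

theorem join_swap (i j : ℤ) (a b : A) (ha : a ∈ 𝒜 i) (hb : b ∈ 𝒜 j) :
    join 𝒜 a * join 𝒜 b = (-1 : ℂ) ^ (i * j) • (join 𝒜 b * join 𝒜 a) := by
  ext w
  have h : (-1 : ℂ) ^ (i * j) * (-1 : ℂ) ^ (i * j) = 1 := by
    rw [← zpow_add₀ (by norm_num), Even.neg_one_zpow ⟨i * j, rfl⟩]
  have h1 : Sym.ι 𝒜 a * (Sym.ι 𝒜 b * w) =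
      (-1 : ℂ) ^ (i * j) • (Sym.ι 𝒜 b * (Sym.ι 𝒜 a * w)) := by
    rw [← mul_assoc, Sym.ι_swap ha hb, smul_mul_assoc, mul_assoc]
  simp only [Module.End.mul_apply, LinearMap.smul_apply, join_apply ha, join_apply hb,
    map_add, mul_add, Sym.derivation_mul, LinearMap.mulLeft_apply, signTwist_apply _ ha,
    signTwist_apply _ hb, derivation_mulLeft_swap 𝒜 ha hb,
    GradedCommutative.mul_swap i j a b ha hb, map_smul, smul_mul_assoc, h1, smul_add, smul_smul]
  rw [mul_comm j i, h, one_smul]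
  abel

/-- The coalgebra map `φ : S A → S A` whose component `S A → A` is `a₁ ⊙ ⋯ ⊙ aₙ ↦ a₁ ⋯ aₙ`. As a map
of coalgebras it is
`φ (a₁ ⊙ ⋯ ⊙ aₙ) = ∑ ± (∏_{i ∈ B₁} aᵢ) ⊙ ⋯ ⊙ (∏_{i ∈ B_k} aᵢ)`,
the sum over the partitions `{B₁, …, B_k}` of the set `{1, …, n}` with their Koszul signs. A partition
of `{1, …, n}` arises from one of `{2, …, n}` when `1` becomes a new block or joins a block, so that
`φ 1 = 1` and `φ (a ⊙ w) = join a (φ w)`, see `cumulantHom_one` and `cumulantHom_mul`. -/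
def cumulantHom : Sym 𝒜 →ₗ[ℂ] Sym 𝒜 :=
  LinearMap.applyₗ (1 : Sym 𝒜) ∘ₗ (Sym.lift 𝒜 (join 𝒜) (join_swap 𝒜)).toLinearMap

theorem cumulantHom_one : cumulantHom 𝒜 1 = 1 := by simp [cumulantHom]

theorem cumulantHom_mul (a : A) (w : Sym 𝒜) :
    cumulantHom 𝒜 (Sym.ι 𝒜 a * w) = join 𝒜 a (cumulantHom 𝒜 w) := by
  simp [cumulantHom]


theorem cumulantHom_zero {w : Sym 𝒜} (hw : w ∈ filt 𝒜 0) : cumulantHom 𝒜 w = w := by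
  obtain ⟨c, rfl⟩ := Submodule.mem_span_singleton.1 hw
  rw [map_smul, cumulantHom_one]

theorem cumulantHom_succ (n : ℕ) :
    filt 𝒜 (n + 1) ≤ (filt 𝒜 n).comap (cumulantHom 𝒜 - LinearMap.id) := by
  induction n with
  | zero =>
    refine filt_le 𝒜 (fun u hu => ?_) fun i a u ha hu => ?_
    · simp [cumulantHom_zero 𝒜 hu]
    · have h := derivation_mem_filt 𝒜 ha 0 hu
      simpa [cumulantHom_mul, join_apply ha, cumulantHom_zero 𝒜 hu] using h
  | succ n ih =>
    refine filt_le 𝒜 (fun u hu => filt_mono 𝒜 n.le_succ (ih hu)) fun i a u ha hu => ?_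
    have h1 := ih hu
    simp only [Submodule.mem_comap, LinearMap.sub_apply, LinearMap.id_apply] at h1 ⊢
    have h2 : cumulantHom 𝒜 u ∈ filt 𝒜 (n + 1) := by
      simpa using Submodule.add_mem _ (filt_mono 𝒜 n.le_succ h1) hu
    rw [cumulantHom_mul, join_apply ha, add_sub_right_comm, ← mul_sub]
    exact Submodule.add_mem _ (ι_mul_mem_filt ha h1) (derivation_mem_filt 𝒜 ha _ h2)

theorem cumulantHom_bijective : Function.Bijective (cumulantHom 𝒜) := by
  constructor
  · rw [injective_iff_map_eq_zero]
    intro w hw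
    obtain ⟨n, hn⟩ := exists_mem_filt 𝒜 w
    induction n with
    | zero => rwa [cumulantHom_zero 𝒜 hn] at hw
    | succ n ih =>
      have h := cumulantHom_succ 𝒜 n hn
      simp only [Submodule.mem_comap, LinearMap.sub_apply, LinearMap.id_apply, hw, zero_sub,
        Submodule.neg_mem_iff] at h
      exact ih h
  · intro w
    obtain ⟨n, hn⟩ := exists_mem_filt 𝒜 w
    suffices h : filt 𝒜 n ≤ LinearMap.range (cumulantHom 𝒜) from h hn
    clear hn
    induction n with
    | zero => exact fun u hu => ⟨u, cumulantHom_zero 𝒜 hu⟩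
    | succ n ih =>
      intro u hu
      obtain ⟨v, hv⟩ := ih (cumulantHom_succ 𝒜 n hu)
      exact ⟨u - v, by rw [map_sub, hv]; simp⟩

/-- The cumulant map, the coalgebra automorphism `φ` of `S A`. -/
def cumulantMap : Sym 𝒜 ≃ₗ[ℂ] Sym 𝒜 :=
  LinearEquiv.ofBijective (cumulantHom 𝒜) (cumulantHom_bijective 𝒜)

variable {𝒜} in
/-- The transported structure `d^φ = φ⁻¹ d φ` on `S A`, for `d` of degree one on `A` extended to `S A`
as a coderivation. -/
def transported (d : A →ₗ[ℂ] A) (hd : ∀ i, ∀ a ∈ 𝒜 i, d a ∈ 𝒜 (i + 1)) : Sym 𝒜 →ₗ[ℂ] Sym 𝒜 :=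
  (cumulantMap 𝒜).symm.toLinearMap ∘ₗ Sym.derivation d 1 hd ∘ₗ (cumulantMap 𝒜).toLinearMap

end Cumulant

end GradedSymmetric


namespace Sym

section Map
variable {M N : Type} [AddCommGroup M] [Module ℂ M] [AddCommGroup N] [Module ℂ N]
  (ℳ : ℤ → Submodule ℂ M) (𝒩 : ℤ → Submodule ℂ N)

/-- The map `S f : a₁ ⊙ ⋯ ⊙ aₙ ↦ f a₁ ⊙ ⋯ ⊙ f aₙ` induced by a linear map `f` of degree zero. -/
def map (f : M →ₗ[ℂ] N) (hf : ∀ i, ∀ a ∈ ℳ i, f a ∈ 𝒩 i) : Sym ℳ →ₐ[ℂ] Sym 𝒩 :=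
  lift ℳ (ι 𝒩 ∘ₗ f) fun i j a b ha hb => ι_swap (hf i a ha) (hf j b hb)

/-- The projection `S M → S¹ M = M` onto words of length one. -/
def wordProj : Sym ℳ →ₗ[ℂ] M :=
  LinearMap.snd ℂ ℂ M ∘ₗ LinearMap.applyₗ ((1, 0) : ℂ × M) ∘ₗ
    (lift ℳ (A := Module.End ℂ (ℂ × M))
      { toFun := fun a => LinearMap.inr ℂ ℂ M ∘ₗ LinearMap.toSpanSingleton ℂ M a ∘ₗ
          LinearMap.fst ℂ ℂ M
        map_add' := fun a b => by ext <;> simp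
        map_smul' := fun c a => by ext <;> simp }
      (fun i j a b _ _ => by ext <;> simp)).toLinearMap

end Map
end Sym

/-- `ℂ`, concentrated in degree zero. -/
def trivialGrading (i : ℤ) : Submodule ℂ ℂ := if i = 0 then ⊤ else ⊥

instance : SetLike.GradedMonoid trivialGrading where
  one_mem := by simp [trivialGrading]
  mul_mem := by
    intro i j a b ha hb
    by_cases hi : i = 0 <;> by_cases hj : j = 0 <;> simp_all [trivialGrading]

theorem trivialGrading_mem {i : ℤ} {a : ℂ} (ha : a ∈ trivialGrading i) (hi : i ≠ 0) : a = 0 := by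
  simpa [trivialGrading, hi] using ha

instance : DirectSum.Decomposition trivialGrading :=
  DirectSum.Decomposition.ofLinearMap trivialGrading
    (DirectSum.lof ℂ ℤ (fun i => trivialGrading i) 0 ∘ₗ
      LinearMap.codRestrict (trivialGrading 0) LinearMap.id fun a => by simp [trivialGrading])
    (by ext; simp)
    (by
      ext i x : 2
      obtain ⟨x, hx⟩ := x
      by_cases hi : i = 0
      · subst hi
        simp only [LinearMap.comp_apply, DirectSum.coeLinearMap_lof]
        rfl
      · obtain rfl := trivialGrading_mem hx hi
        rw [show (⟨0, hx⟩ : trivialGrading i) = 0 from rfl, map_zero, map_zero])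

instance : GradedAlgebra trivialGrading where

instance : GradedCommutative trivialGrading where
  mul_swap i j a b ha hb := by
    by_cases hi : i = 0
    · subst hi; simp [mul_comm]
    · simp [trivialGrading_mem ha hi]

section Cumulants

/-! ### `L∞` morphisms out of `(ℂ, 0)` and cumulants

A coalgebra map `F` out of `S ℂ` is determined by its components `Fₙ : Sⁿ ℂ → A`, and each `Sⁿ ℂ` is
spanned by `1 ⊙ ⋯ ⊙ 1`. So `F` is given by the sequence of the elements `Fₙ (1 ⊙ ⋯ ⊙ 1)`, `n ≥ 1`. -/

/-- The value at `1 ⊙ ⋯ ⊙ 1` (`n` factors) of the coalgebra map out of `S ℂ` with components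
`f n` of degree zero:
the sum of `f |B₁| ⊙ ⋯ ⊙ f |B_k|` over the partitions `{B₁, …, B_k}` of the set `{1, …, n}`. (The type
`OrderedFinpartition n` has one element for each set partition.) -/
def coalgebraExtension {R : Type} [Ring R] (f : ℕ → R) (n : ℕ) : R :=
  ∑ π : OrderedFinpartition n, (List.ofFn fun i => f (π.partSize i)).prod

variable {A : Type} [Ring A] [Algebra ℂ A] (𝒜 : ℤ → Submodule ℂ A) [GradedAlgebra 𝒜]

variable {𝒜} in
/-- `X` is an `L∞` morphism from `(ℂ, 0)` to `(A, Q)`: the coalgebra map `S ℂ → S A` with components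
`X n` has degree zero and its composition with `Q` vanishes. -/
structure IsLInfMorphism (Q : Sym 𝒜 →ₗ[ℂ] Sym 𝒜) (X : ℕ → A) : Prop where
  degree_zero : ∀ n, 1 ≤ n → X n ∈ 𝒜 0
  closed : ∀ n, 1 ≤ n → Q (coalgebraExtension (fun k => Sym.ι 𝒜 (X k)) n) = 0

variable [GradedCommutative 𝒜]

variable {𝒜} in
/-- The total cumulant `K = φ⁻¹ E φ : S A → S ℂ` of an expectation map `E : A → ℂ`. -/
def totalCumulant (E : A →ₗ[ℂ] ℂ) (hE : ∀ i, ∀ a ∈ 𝒜 i, E a ∈ trivialGrading i) :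
    Sym 𝒜 →ₗ[ℂ] Sym trivialGrading :=
  (cumulantMap trivialGrading).symm.toLinearMap ∘ₗ (Sym.map 𝒜 trivialGrading E hE).toLinearMap ∘ₗ
    (cumulantMap 𝒜).toLinearMap

variable {𝒜} in
/-- The `n`-th cumulant of `X`: the component `κₙ : Sⁿ ℂ → ℂ` of the composition `K X`, at
`1 ⊙ ⋯ ⊙ 1`. -/
def cumulant (E : A →ₗ[ℂ] ℂ) (hE : ∀ i, ∀ a ∈ 𝒜 i, E a ∈ trivialGrading i) (X : ℕ → A) (n : ℕ) : ℂ :=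
  Sym.wordProj trivialGrading
    (totalCumulant E hE (coalgebraExtension (fun k => Sym.ι 𝒜 (X k)) n))

end Cumulants

section Homotopy

/-! ### The algebras `ℂ[x, η]` and `ℂ[t, dt]`, and `L∞` homotopies

Both algebras have one polynomial generator of degree zero and one generator `ε` of odd degree `e`
with `ε² = 0`, so both are dual numbers over a polynomial ring: `ε` is `η` with `e = -1`, and `dt`
with `e = 1`. -/

open Polynomial

/-- The grading in which the polynomials have degree `0` and `ε` has degree `e`. -/
def dualGrading (e : ℤ) (i : ℤ) : Submodule ℂ (DualNumber ℂ[X]) where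
  carrier := {v | (i ≠ 0 → v.fst = 0) ∧ (i ≠ e → v.snd = 0)}
  add_mem' := by
    rintro a b ⟨h1, h2⟩ ⟨h3, h4⟩
    exact ⟨fun h => by simp [h1 h, h3 h], fun h => by simp [h2 h, h4 h]⟩
  zero_mem' := by simp
  smul_mem' := by
    rintro c a ⟨h1, h2⟩
    exact ⟨fun h => by simp [h1 h], fun h => by simp [h2 h]⟩


variable (e : ℤ)

instance : SetLike.GradedMonoid (dualGrading e) where
  one_mem := ⟨fun h => absurd rfl h, fun _ => by simp⟩
  mul_mem := by
    rintro i j a b ⟨ha, ha'⟩ ⟨hb, hb'⟩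
    constructor
    · intro h
      by_cases hi : i = 0
      · have hj : j ≠ 0 := by omega
        simp [hb hj]
      · simp [ha hi]
    · intro h
      have h1 : a.fst • b.snd = 0 := by
        by_cases hi : i = 0
        · have hj : j ≠ e := by omega
          simp [hb' hj]
        · simp [ha hi]
      have h2 : MulOpposite.op b.fst • a.snd = 0 := by
        by_cases hj : j = 0
        · have hi : i ≠ e := by omega
          simp [ha' hi]
        · simp [hb hj]
      rw [TrivSqZeroExt.snd_mul, h1, h2, add_zero]

variable [NeZero e]

instance : NeZero (-1 : ℤ) := ⟨by decide⟩

/-- The decomposition `p + q ε = p + (q ε)` into homogeneous parts. -/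
def dualDecompose : DualNumber ℂ[X] →ₗ[ℂ] ⨁ i, dualGrading e i :=
  DirectSum.lof ℂ ℤ (fun i => dualGrading e i) 0 ∘ₗ
      LinearMap.codRestrict (dualGrading e 0)
        { toFun := fun v => TrivSqZeroExt.inl v.fst
          map_add' := fun a b => by simp
          map_smul' := fun c a => by simp }
        (fun v => ⟨fun h => absurd rfl h, fun _ => by simp⟩) +
    DirectSum.lof ℂ ℤ (fun i => dualGrading e i) e ∘ₗ
      LinearMap.codRestrict (dualGrading e e)
        { toFun := fun v => TrivSqZeroExt.inr v.snd
          map_add' := fun a b => TrivSqZeroExt.ext (by simp) (by simp)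
          map_smul' := fun c a => TrivSqZeroExt.ext (by simp) (by simp) }
        (fun v => ⟨fun _ => by simp, fun h => absurd rfl h⟩)

theorem dualDecompose_apply (v : DualNumber ℂ[X]) (h0 : TrivSqZeroExt.inl v.fst ∈ dualGrading e 0)
    (he : TrivSqZeroExt.inr v.snd ∈ dualGrading e e) :
    dualDecompose e v = DirectSum.lof ℂ ℤ (fun i => dualGrading e i) 0 ⟨_, h0⟩ +
      DirectSum.lof ℂ ℤ (fun i => dualGrading e i) e ⟨_, he⟩ := rfl

instance : DirectSum.Decomposition (dualGrading e) :=
  DirectSum.Decomposition.ofLinearMap (dualGrading e) (dualDecompose e)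
    (LinearMap.ext fun v => by
      rw [LinearMap.comp_apply, dualDecompose_apply e v ⟨fun h => absurd rfl h, fun _ => by simp⟩
        ⟨fun _ => by simp, fun h => absurd rfl h⟩, map_add, DirectSum.coeLinearMap_lof,
        DirectSum.coeLinearMap_lof]
      exact TrivSqZeroExt.inl_fst_add_inr_snd_eq v)
    (by
      have he : e ≠ 0 := NeZero.ne e
      refine DirectSum.linearMap_ext ℂ fun i => LinearMap.ext fun x => ?_
      obtain ⟨x, hx⟩ := x
      simp only [LinearMap.comp_apply, DirectSum.coeLinearMap_lof, LinearMap.id_apply]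
      have hx' := hx
      obtain ⟨h1, h2⟩ := hx'
      rw [dualDecompose_apply e x ⟨fun h => absurd rfl h, fun _ => by simp⟩
        ⟨fun _ => by simp, fun h => absurd rfl h⟩]
      by_cases hi : i = 0
      · subst hi
        have h3 : x.snd = 0 := h2 he.symm
        have h4 : (TrivSqZeroExt.inl x.fst : DualNumber ℂ[X]) = x :=
          TrivSqZeroExt.ext (by simp) (by simp [h3])
        simp only [h3, TrivSqZeroExt.inr_zero, h4]
        exact (congrArg _ (map_zero _)).trans (add_zero _)
      · have h3 : x.fst = 0 := h1 hi
        by_cases hie : i = e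
        · subst hie
          have h4 : (TrivSqZeroExt.inr x.snd : DualNumber ℂ[X]) = x :=
            TrivSqZeroExt.ext (by simp [h3]) (by simp)
          simp only [h3, TrivSqZeroExt.inl_zero, h4]
          exact (congrArg (· + _) (map_zero _)).trans (zero_add _)
        · obtain rfl : x = 0 := TrivSqZeroExt.ext h3 (h2 hie)
          simp only [TrivSqZeroExt.fst_zero, TrivSqZeroExt.snd_zero, TrivSqZeroExt.inl_zero,
            TrivSqZeroExt.inr_zero]
          rw [show (⟨0, hx⟩ : dualGrading e i) = 0 from rfl, map_zero]
          exact (congrArg₂ (· + ·) (map_zero _) (map_zero _)).trans (add_zero _))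

instance : GradedAlgebra (dualGrading e) where

instance : GradedCommutative (dualGrading e) where
  mul_swap i j a b ha hb := by
    by_cases hi : i = 0
    · subst hi; simp [mul_comm]
    by_cases hj : j = 0
    · subst hj; simp [mul_comm]
    have h1 : a.fst = 0 := ha.1 hi
    have h2 : b.fst = 0 := hb.1 hj
    have h3 : a * b = 0 := TrivSqZeroExt.ext (by simp [h1]) (by simp [h1, h2])
    rw [mul_comm b a, h3, smul_zero]

/-- The de Rham differential of `ℂ[t, dt]`. -/
def deRham : DualNumber ℂ[X] →ₗ[ℂ] DualNumber ℂ[X] where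
  toFun w := TrivSqZeroExt.inr (derivative w.fst)
  map_add' v w := TrivSqZeroExt.ext (by simp) (by simp)
  map_smul' c v := TrivSqZeroExt.ext (by simp) (by simp)

/-- The evaluation `ℂ[t, dt] → ℂ` with `t ↦ s` and `dt ↦ 0`. -/
def evalForm (s : ℂ) : DualNumber ℂ[X] →ₗ[ℂ] ℂ where
  toFun w := w.fst.eval s
  map_add' v w := by simp
  map_smul' c v := by simp

variable {A : Type} [Ring A] [Algebra ℂ A] (𝒜 : ℤ → Submodule ℂ A) [GradedAlgebra 𝒜]

/-- `A ⊗ ℂ[t, dt]` with the product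
`(a ⊗ ω) (a' ⊗ ω') = (-1)^{|ω||a'|} a a' ⊗ ω ω'`. -/
abbrev FormsIn : Type := 𝒜 ᵍ⊗[ℂ] (dualGrading 1)

/-- The part of `A ⊗ ℂ[t, dt]` of total degree `n`. -/
def formsDegree (n : ℤ) : Submodule ℂ (FormsIn 𝒜) :=
  Submodule.span ℂ {z | ∃ i j : ℤ, i + j = n ∧ ∃ a ∈ 𝒜 i, ∃ ω ∈ dualGrading 1 j,
    z = GradedTensorProduct.tmul ℂ a ω}

/-- The evaluation `A ⊗ ℂ[t, dt] → A` with `t ↦ s` and `dt ↦ 0`. -/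
def evalForms (s : ℂ) : FormsIn 𝒜 →ₗ[ℂ] A :=
  (TensorProduct.rid ℂ A).toLinearMap ∘ₗ TensorProduct.map LinearMap.id (evalForm s) ∘ₗ
    (GradedTensorProduct.of ℂ 𝒜 (dualGrading 1)).symm.toLinearMap

/-- The inclusion `A ⊗ ℂ[t, dt] → S A ⊗ ℂ[t, dt]`. -/
def formsι : FormsIn 𝒜 →ₗ[ℂ] FormsIn (Sym.grading 𝒜) :=
  (GradedTensorProduct.of ℂ (Sym.grading 𝒜) (dualGrading 1)).toLinearMap ∘ₗ
    TensorProduct.map (Sym.ι 𝒜) LinearMap.id ∘ₗ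
    (GradedTensorProduct.of ℂ 𝒜 (dualGrading 1)).symm.toLinearMap

variable {𝒜} in
/-- The differential `Q ⊗ 1 + 1 ⊗ d_dR` on `S A ⊗ ℂ[t, dt]`, that is
`w ⊗ ω ↦ Q w ⊗ ω + (-1)^{|w|} w ⊗ d_dR ω`. -/
def formsDiff (Q : Sym 𝒜 →ₗ[ℂ] Sym 𝒜) :
    FormsIn (Sym.grading 𝒜) →ₗ[ℂ] FormsIn (Sym.grading 𝒜) :=
  (GradedTensorProduct.of ℂ (Sym.grading 𝒜) (dualGrading 1)).toLinearMap ∘ₗ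
    (TensorProduct.map Q LinearMap.id +
      TensorProduct.map (signTwist (Sym.grading 𝒜) 1) deRham) ∘ₗ
    (GradedTensorProduct.of ℂ (Sym.grading 𝒜) (dualGrading 1)).symm.toLinearMap

variable {𝒜} in
/-- `H` is an `L∞` homotopy from `(ℂ, 0)` to `(A, Q)` between the `L∞` morphisms `X` and `Y`: an `L∞`
morphism `S ℂ → S A ⊗ ℂ[t, dt]`, given by its components `H n` in `A ⊗ ℂ[t, dt]`, with
`H(0) = X` and `H(1) = Y`. -/
structure IsLInfHomotopy (Q : Sym 𝒜 →ₗ[ℂ] Sym 𝒜) (X Y : ℕ → A) (H : ℕ → FormsIn 𝒜) : Prop where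
  left : IsLInfMorphism Q X
  right : IsLInfMorphism Q Y
  degree_zero : ∀ n, 1 ≤ n → H n ∈ formsDegree 𝒜 0
  closed : ∀ n, 1 ≤ n → formsDiff Q (coalgebraExtension (fun k => formsι 𝒜 (H k)) n) = 0
  eval_zero : ∀ n, 1 ≤ n → evalForms 𝒜 0 (H n) = X n
  eval_one : ∀ n, 1 ≤ n → evalForms 𝒜 1 (H n) = Y n

end Homotopy

section Gaussian

/-! ### The homotopy Gaussian -/

open Polynomial

/-- The underlying algebra `V = ℂ[x, η]` of the homotopy Gaussian; `p + q η` is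
`TrivSqZeroExt.inl p + TrivSqZeroExt.inr q`. -/
abbrev GaussV : Type := DualNumber ℂ[X]

/-- The grading of `V`: `x` has degree `0` and `η` has degree `-1`. -/
abbrev gaussGrading : ℤ → Submodule ℂ GaussV := dualGrading (-1)

theorem integrable_aux (p : ℂ[X]) :
    MeasureTheory.Integrable fun x : ℝ => p.eval (x : ℂ) * (Real.exp (-x ^ 2 / 2) : ℂ) := by
  induction p using Polynomial.induction_on' with
  | add p q hp hq =>
    refine (hp.add hq).congr (MeasureTheory.ae_of_all _ fun x => ?_)
    simp [add_mul]
  | monomial n a =>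
    have h := (integrable_rpow_mul_exp_neg_mul_sq (b := 1 / 2) (by norm_num) (s := n)
      (by linarith [(Nat.cast_nonneg n : (0 : ℝ) ≤ n)])).ofReal (𝕜 := ℂ)
    refine (h.const_mul a).congr (MeasureTheory.ae_of_all _ fun x => ?_)
    have hx : -(1 / 2) * x ^ 2 = -x ^ 2 / 2 := by ring
    change a * ((x ^ (n : ℝ) * Real.exp (-(1 / 2) * x ^ 2) : ℝ) : ℂ) = _
    change _ = (monomial n a).eval (x : ℂ) * (Real.exp (-x ^ 2 / 2) : ℂ)
    rw [hx, eval_monomial, Real.rpow_natCast, Complex.ofReal_mul, Complex.ofReal_pow, mul_assoc]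


/-- The expectation `E(p + q η) = ∫ p e^{-x²/2} / ∫ e^{-x²/2}`. -/
def expectation : DualNumber ℂ[X] →ₗ[ℂ] ℂ where
  toFun v := (∫ x : ℝ, v.fst.eval (x : ℂ) * (Real.exp (-x ^ 2 / 2) : ℂ)) /
    ∫ x : ℝ, (Real.exp (-x ^ 2 / 2) : ℂ)
  map_add' v w := by
    simp only [TrivSqZeroExt.fst_add, eval_add, add_mul]
    rw [MeasureTheory.integral_add (integrable_aux _) (integrable_aux _), add_div]
  map_smul' c v := by
    simp only [TrivSqZeroExt.fst_smul, eval_smul, smul_eq_mul, mul_assoc, RingHom.id_apply]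
    rw [MeasureTheory.integral_const_mul, mul_div_assoc]

theorem expectation_degree (i : ℤ) (v : DualNumber ℂ[X]) (hv : v ∈ dualGrading (-1) i) :
    expectation v ∈ trivialGrading i := by
  by_cases hi : i = 0
  · simp [trivialGrading, hi]
  · simp [expectation, hv.1 hi]

/-- The differential `d(p + q η) = q' - x q`. -/
def diff : DualNumber ℂ[X] →ₗ[ℂ] DualNumber ℂ[X] where
  toFun v := TrivSqZeroExt.inl (derivative v.snd - X * v.snd)
  map_add' v w := TrivSqZeroExt.ext (by simp; ring) (by simp)
  map_smul' c v := TrivSqZeroExt.ext (by simp [smul_sub]) (by simp)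

theorem diff_degree (i : ℤ) (v : DualNumber ℂ[X]) (hv : v ∈ dualGrading (-1) i) :
    diff v ∈ dualGrading (-1) (i + 1) := by
  refine ⟨fun hi => ?_, fun _ => by simp [diff]⟩
  have h : v.snd = 0 := hv.2 (by omega)
  simp [diff, h]

/-- The transported structure `d^φ` of the homotopy Gaussian. -/
def gaussTransported : Sym gaussGrading →ₗ[ℂ] Sym gaussGrading :=
  transported diff diff_degree

/-- The cumulants in the homotopy Gaussian. -/
def gaussCumulant (X : ℕ → GaussV) (n : ℕ) : ℂ :=
  cumulant expectation expectation_degree X n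

/-- The ordinary random variable `X` with `X(1) = p(x)` and all higher terms zero. -/
def ordinaryVariable (p : ℂ[X]) (n : ℕ) : GaussV :=
  if n = 1 then TrivSqZeroExt.inl p else 0

/-- `yₙ = -η ∑_{1 ≤ j ≤ (n+1)/2} (n-1)‼ / (n+1-2j)‼ x^{n+1-2j}`, so that
`d yₙ = xⁿ - E(xⁿ)` for `n ≥ 1`. -/
def gaussY (n : ℕ) : GaussV :=
  -TrivSqZeroExt.inr (∑ j ∈ Finset.Icc 1 ((n + 1) / 2),
    C (((n - 1)‼ : ℂ) / ((n + 1 - 2 * j)‼ : ℂ)) * X ^ (n + 1 - 2 * j))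

/-- `h(r) = ∑_{i ≥ 1} aᵢ yᵢ`, where `aᵢ` is the coefficient of `xⁱ` in `r`. If `E(r) = 0` then
`r = ∑_{i ≥ 1} aᵢ (xⁱ - E(xⁱ))` and `d (h(r)) = r`. -/
def gaussH (r : ℂ[X]) : GaussV :=
  ∑ i ∈ Finset.Icc 1 r.natDegree, r.coeff i • gaussY i

/-- `Λₙ = pⁿ + t (qⁿ - pⁿ) + h(pⁿ - qⁿ) dt` in `V ⊗ ℂ[t, dt]`. -/
def gaussLambda (p q : ℂ[X]) (n : ℕ) : FormsIn gaussGrading :=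
  GradedTensorProduct.tmul ℂ (TrivSqZeroExt.inl (p ^ n) : GaussV) (1 : DualNumber ℂ[X]) +
    GradedTensorProduct.tmul ℂ (TrivSqZeroExt.inl (q ^ n - p ^ n) : GaussV)
      (TrivSqZeroExt.inl X : DualNumber ℂ[X]) +
    GradedTensorProduct.tmul ℂ (gaussH (p ^ n - q ^ n)) (DualNumber.eps : DualNumber ℂ[X])

/-- `Hₙ(1 ⊙ ⋯ ⊙ 1)`: the sum of `(-1)^{k-1} (k-1)! Λ_{p₁} ⋯ Λ_{p_k}` over all partitions of the set
`{1, …, n}`, where `k` is the number of blocks and `p₁, …, p_k` are their sizes. -/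
def gaussHomotopy (p q : ℂ[X]) (n : ℕ) : FormsIn gaussGrading :=
  ∑ π : OrderedFinpartition n, ((-1 : ℂ) ^ (π.length - 1) * ((π.length - 1)! : ℂ)) •
    (List.ofFn fun i => gaussLambda p q (π.partSize i)).prod

end Gaussian

end HomotopyProbability

end

/-! The cumulant map `φ` passes from cumulants to moments: it sends the coalgebra map with
components `f n` to the one whose components are the partition sums of products of the `f k`. For an
ordinary variable `p` these moments are the powers `p ^ n`. The components `H n` are the
Möbius-weighted partition sums of the `Λ k`, that is, their formal cumulants, so `φ ⊗ 1` carries the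
coalgebra map with components `H n` to the one with components `Λ n`.

Since `d^φ = φ⁻¹ d φ`, closedness of `H` reduces to closedness of each `Λ n` under the linear
differential `d ⊗ 1 + 1 ⊗ d_dR`. There the term `(qⁿ - pⁿ) dt` from the de Rham differential cancels
`d h(pⁿ - qⁿ) dt`. The identity `d h(r) = r` needs `E(r) = 0`, that is `E(pⁿ) = E(qⁿ)`: equal
cumulants give equal moments, by the same inversion over `ℂ`. At the endpoints, evaluation is an
algebra map that kills `dt`, so `H n` becomes the `n`-th cumulant of the moment sequence `p ^ k` or
`q ^ k`, which is the variable itself for `n = 1` and zero afterwards.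

Two universal facts carry the argument: moments and cumulants are mutually inverse
(`moment_cumulant`, `cumulant_moment`), and any map with the recursion of `φ` replaces components by
moments (`map_coalgebraExtension_eq_moments`). Both are proved in polynomial rings, where adding one
point to a set partition is the action of a derivation, and are then transported along algebra maps.
The targets are noncommutative, but elements of total degree zero commute, which is all that the
transport requires. -/

noncomputable section

namespace HomotopyProbability

/-! ### Sums over set partitions -/

section Partitions

/-- The additional point either forms a block of its own (`extendLeft`) or joins the block `k`
(`extendMiddle k`). All later recursions rest on this dichotomy. -/
theorem sum_orderedFinpartition_succ {R : Type} [AddCommMonoid R] (n : ℕ)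
    (G : OrderedFinpartition (n + 1) → R) :
    ∑ π, G π = ∑ π : OrderedFinpartition n,
      (G π.extendLeft + ∑ k, G (π.extendMiddle k)) := by
  rw [← (OrderedFinpartition.extendEquiv n).sum_comp, Fintype.sum_sigma]
  simp [Fintype.sum_option]

/-- The sum of `c k • (f |B₁| ⋯ f |B_k|)` over the partitions `{B₁, …, B_k}` of `{1, …, n}`. -/
def partitionSum {R : Type} [Ring R] [Algebra ℂ R] (c : ℕ → ℂ) (f : ℕ → R) (n : ℕ) : R :=
  ∑ π : OrderedFinpartition n, c π.length • (List.ofFn fun i => f (π.partSize i)).prod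

/-- The coefficients `(-1)^{k-1} (k-1)!` that express cumulants through moments. -/
def cumulantCoeff (k : ℕ) : ℂ := (-1 : ℂ) ^ (k - 1) * ((k - 1)! : ℂ)

variable {R S : Type} [Ring R] [Algebra ℂ R] [Ring S] [Algebra ℂ S]

theorem coalgebraExtension_eq_partitionSum (f : ℕ → R) (n : ℕ) :
    coalgebraExtension f n = partitionSum 1 f n := by
  simp [coalgebraExtension, partitionSum]

theorem map_partitionSum (F : R →ₐ[ℂ] S) (c : ℕ → ℂ) (f : ℕ → R) (n : ℕ) :
    F (partitionSum c f n) = partitionSum c (fun k => F (f k)) n := by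
  simp [partitionSum, map_list_prod, List.map_ofFn, Function.comp_def]

theorem partitionSum_congr (c : ℕ → ℂ) {f g : ℕ → R} (h : ∀ k, 1 ≤ k → f k = g k) (n : ℕ) :
    partitionSum c f n = partitionSum c g n :=
  Finset.sum_congr rfl fun π _ => by simp only [fun i => h _ (π.partSize_pos i)]

theorem map_coalgebraExtension (F : R →ₐ[ℂ] S) (f : ℕ → R) (n : ℕ) :
    F (coalgebraExtension f n) = coalgebraExtension (fun k => F (f k)) n := by
  simp only [coalgebraExtension_eq_partitionSum, map_partitionSum]

theorem coalgebraExtension_congr {f g : ℕ → R} (h : ∀ k, 1 ≤ k → f k = g k) (n : ℕ) :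
    coalgebraExtension f n = coalgebraExtension g n := by
  simp only [coalgebraExtension_eq_partitionSum, partitionSum_congr 1 h]

theorem partitionSum_zero (c : ℕ → ℂ) (f : ℕ → R) :
    partitionSum c f 0 = c 0 • 1 := by
  rw [partitionSum, Fintype.sum_unique]
  have : (default : OrderedFinpartition 0) = OrderedFinpartition.atomic 0 := rfl
  simp [this]

end Partitions

/-! ### Recursions for partition sums by derivations -/

section Recursion

variable {R : Type} [CommRing R] [Algebra ℂ R] (D : Derivation ℂ R R)

/-- The Leibniz rule, in the `Function.update` form that matches the effect of `extendMiddle` on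
block sizes. -/
theorem derivation_prod_univ {n : ℕ} (g : Fin n → R) :
    D (∏ i, g i) = ∑ i, ∏ j, Function.update g i (D (g i)) j := by
  have h (s : Finset (Fin n)) :
      D (∏ i ∈ s, g i) = ∑ i ∈ s, (∏ j ∈ s \ {i}, g j) * D (g i) := by
    induction s using Finset.induction_on with
    | empty => simp
    | insert a s ha ih =>
      rw [Finset.prod_insert ha, D.leibniz, ih, Finset.sum_insert ha, smul_eq_mul, smul_eq_mul,
        add_comm, Finset.mul_sum]
      congr 1
      · congr 2
        ext x; simp only [Finset.mem_sdiff, Finset.mem_insert, Finset.mem_singleton]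
        constructor
        · intro hx; exact ⟨Or.inr hx, fun h => ha (h ▸ hx)⟩
        · rintro ⟨h | h, h'⟩
          · exact absurd h h'
          · exact h
      · refine Finset.sum_congr rfl fun i hi => ?_
        have hai : a ≠ i := fun h => ha (h ▸ hi)
        rw [Finset.insert_sdiff_of_notMem _ (by simpa using hai),
          Finset.prod_insert (by simp [ha]), mul_assoc]
  rw [h]
  refine Finset.sum_congr rfl fun i _ => ?_
  rw [Finset.prod_update_of_mem (Finset.mem_univ i), mul_comm]

/-- Differentiating the factor of block `k` enlarges that block by one point. The correction `u * f
k` reproduces the whole product once per block, whence the factor `π.length`. -/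
theorem derivation_prod_partSize {f : ℕ → R} {u : R}
    (hD : ∀ k, 1 ≤ k → D (f k) = f (k + 1) + u * f k) {n : ℕ} (π : OrderedFinpartition n) :
    D (∏ i, f (π.partSize i)) =
      (∑ k, ∏ i, f ((π.extendMiddle k).partSize i)) +
        π.length * (u * ∏ i, f (π.partSize i)) := by
  rw [derivation_prod_univ]
  have h (k : Fin π.length) :
      ∏ j, Function.update (fun i => f (π.partSize i)) k (D (f (π.partSize k))) j =
        (∏ i, f ((π.extendMiddle k).partSize i)) + u * ∏ i, f (π.partSize i) := by
    have h1 : (∏ i, f ((π.extendMiddle k).partSize i)) =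
        ∏ j, Function.update (fun i => f (π.partSize i)) k (f (π.partSize k + 1)) j := by
      refine Finset.prod_congr rfl fun (j : Fin π.length) _ => ?_
      rw [OrderedFinpartition.extendMiddle_partSize]
      exact Function.apply_update (fun _ => f) π.partSize k (π.partSize k + 1) j
    rw [h1, Finset.prod_update_of_mem (Finset.mem_univ k), hD _ (π.partSize_pos k),
      Finset.prod_update_of_mem (Finset.mem_univ k), add_mul, mul_assoc,
      ← Finset.prod_sdiff (Finset.subset_univ {k}), Finset.prod_singleton]
    ring
  simp only [h, Finset.sum_add_distrib, Finset.sum_const, Finset.card_univ, Fintype.card_fin,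
    nsmul_eq_mul]

theorem partitionSum_succ (c : ℕ → ℂ) {f : ℕ → R} {u : R}
    (hD : ∀ k, 1 ≤ k → D (f k) = f (k + 1) + u * f k) (n : ℕ) :
    partitionSum c f (n + 1) = ∑ π : OrderedFinpartition n,
      (c (π.length + 1) • (f 1 * ∏ i, f (π.partSize i)) +
        c π.length • (D (∏ i, f (π.partSize i)) -
          π.length * (u * ∏ i, f (π.partSize i)))) := by
  simp only [partitionSum, sum_orderedFinpartition_succ, List.prod_ofFn]
  refine Finset.sum_congr rfl fun π _ => ?_
  rw [derivation_prod_partSize D hD, add_sub_cancel_right, Finset.smul_sum]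
  congr 1
  rw [OrderedFinpartition.extendLeft_partSize]
  congr 1
  exact (Fin.prod_univ_succ _).trans (by simp)

theorem coalgebraExtension_succ {f : ℕ → R} (hD : ∀ k, 1 ≤ k → D (f k) = f (k + 1)) (n : ℕ) :
    coalgebraExtension f (n + 1) = f 1 * coalgebraExtension f n + D (coalgebraExtension f n) := by
  rw [coalgebraExtension_eq_partitionSum, partitionSum_succ D (u := 0) 1 (by simpa using hD)]
  simp only [coalgebraExtension, List.prod_ofFn, map_sum, Finset.mul_sum,
    ← Finset.sum_add_distrib]
  simp

/-- Here `f k` behaves like `M⁽ᵏ⁾ / M` for a moment generating function `M`, and the partition sum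
like `(log M)⁽ⁿ⁾`. The correction `-f 1 * f k`, collected over the blocks, cancels the partitions
with a new singleton because `cumulantCoeff (k + 1) = -k * cumulantCoeff k` for `k ≥ 1`. -/
theorem partitionSum_cumulantCoeff_succ {f : ℕ → R}
    (hD : ∀ k, 1 ≤ k → D (f k) = f (k + 1) - f 1 * f k) {n : ℕ} (hn : 1 ≤ n) :
    partitionSum cumulantCoeff f (n + 1) = D (partitionSum cumulantCoeff f n) := by
  rw [partitionSum_succ D (u := -f 1) _ (fun k hk => by rw [hD k hk]; ring)]
  simp only [partitionSum, List.prod_ofFn, map_sum, Derivation.map_smul]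
  refine Finset.sum_congr rfl fun π _ => ?_
  -- This is where `1 ≤ n` enters: with no blocks, truncated subtraction gives `cumulantCoeff 0 = 1`
  -- and the relation between consecutive coefficients fails.
  obtain ⟨m, hm⟩ : ∃ m, π.length = m + 1 :=
    ⟨π.length - 1, by have := π.length_pos hn; omega⟩
  have h : cumulantCoeff (π.length + 1) = -(cumulantCoeff π.length * π.length) := by
    simp only [hm, cumulantCoeff, Nat.add_sub_cancel, Nat.factorial_succ, pow_succ]
    push_cast
    ring
  rw [h, smul_sub, neg_smul, mul_smul]
  have h2 : ((π.length : ℂ) • (f 1 * ∏ i, f (π.partSize i))) =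
      (π.length : R) * (f 1 * ∏ i, f (π.partSize i)) := by
    rw [Nat.cast_smul_eq_nsmul, nsmul_eq_mul]
  rw [h2]
  simp only [neg_mul, mul_neg, smul_neg]
  abel

theorem partitionSum_one (c : ℕ → ℂ) (f : ℕ → R) : partitionSum c f 1 = c 1 • f 1 := by
  rw [partitionSum, Fintype.sum_unique]
  have : (default : OrderedFinpartition 1) = OrderedFinpartition.atomic 1 :=
    Subsingleton.elim _ _
  simp [this]

theorem coalgebraExtension_zero {R : Type} [Ring R] [Algebra ℂ R] (f : ℕ → R) :
    coalgebraExtension f 0 = 1 := by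
  simp [coalgebraExtension_eq_partitionSum, partitionSum_zero]

end Recursion

/-! ### Inversion of moments and cumulants in the universal case -/

section Universal

open MvPolynomial

/-- The polynomial ring in variables `x₁, x₂, …`; the variable `x_k` is `X (k - 1)`. -/
abbrev SizePoly : Type := MvPolynomial ℕ ℂ

/-- The variable `x_k` for `k ≥ 1`. -/
def sizeVar (k : ℕ) : SizePoly := X (k - 1)

/-- The derivation `x_k ↦ x_{k+1}`. -/
def shiftDeriv : Derivation ℂ SizePoly SizePoly := mkDerivation ℂ fun k => X (k + 1)

theorem shiftDeriv_sizeVar {k : ℕ} (hk : 1 ≤ k) : shiftDeriv (sizeVar k) = sizeVar (k + 1) := by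
  obtain ⟨m, rfl⟩ := Nat.exists_eq_add_of_le' hk
  simp [shiftDeriv, sizeVar, mkDerivation_X]

/-- The derivation `x_k ↦ x_{k+1} - x₁ x_k`. -/
def centredDeriv : Derivation ℂ SizePoly SizePoly :=
  mkDerivation ℂ fun k => X (k + 1) - X 0 * X k

theorem centredDeriv_sizeVar {k : ℕ} (hk : 1 ≤ k) :
    centredDeriv (sizeVar k) = sizeVar (k + 1) - sizeVar 1 * sizeVar k := by
  obtain ⟨m, rfl⟩ := Nat.exists_eq_add_of_le' hk
  simp [centredDeriv, sizeVar, mkDerivation_X]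

/-- `centredDeriv` raises the index of the cumulants, so their moments satisfy `m (n + 1) = x₁ m n +
D (m n)`. The variables satisfy the same recursion by the definition of `centredDeriv`, with the
same initial value. -/
theorem moment_cumulant_sizeVar {n : ℕ} (hn : 1 ≤ n) :
    coalgebraExtension (partitionSum cumulantCoeff sizeVar) n = sizeVar n := by
  have hD : ∀ k, 1 ≤ k → centredDeriv (partitionSum cumulantCoeff sizeVar k) =
      partitionSum cumulantCoeff sizeVar (k + 1) := fun k hk =>
    (partitionSum_cumulantCoeff_succ (f := sizeVar) centredDeriv
      (fun _ h => centredDeriv_sizeVar h) hk).symm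
  have h1 : partitionSum cumulantCoeff sizeVar 1 = sizeVar 1 := by
    simp [partitionSum_one, cumulantCoeff]
  have hs := coalgebraExtension_succ (f := partitionSum cumulantCoeff sizeVar) centredDeriv hD
  induction n, hn using Nat.le_induction with
  | base => rw [hs, coalgebraExtension_zero, h1]; simp
  | succ n hn ih =>
    rw [hs, ih, centredDeriv_sizeVar hn, h1]
    ring

/-- The recursion for moments, read backwards, says that `shiftDeriv` acts on them by the centred
rule. Their cumulants are therefore the iterated shifts of `x₁`. -/
theorem cumulant_moment_sizeVar {n : ℕ} (hn : 1 ≤ n) :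
    partitionSum cumulantCoeff (coalgebraExtension sizeVar) n = sizeVar n := by
  have hs := coalgebraExtension_succ shiftDeriv (fun _ => shiftDeriv_sizeVar)
  have h1 : coalgebraExtension sizeVar 1 = sizeVar 1 := by
    rw [hs]; simp [coalgebraExtension_zero]
  have hD : ∀ k, 1 ≤ k → shiftDeriv (coalgebraExtension sizeVar k) =
      coalgebraExtension sizeVar (k + 1) - coalgebraExtension sizeVar 1 *
        coalgebraExtension sizeVar k := fun k _ => by
    rw [hs k, h1]; ring
  induction n, hn using Nat.le_induction with
  | base => simp [partitionSum_one, cumulantCoeff, h1]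
  | succ n hn ih =>
    rw [partitionSum_cumulantCoeff_succ shiftDeriv hD hn, ih, shiftDeriv_sizeVar hn]

/-- Pairwise commuting elements generate a commutative subalgebra. This lets polynomial identities
be evaluated in graded algebras and in endomorphism rings. -/
theorem exists_algHom_of_commute {R σ : Type} [Ring R] [Algebra ℂ R] (f : σ → R)
    (hf : ∀ i j, Commute (f i) (f j)) : ∃ F : MvPolynomial σ ℂ →ₐ[ℂ] R, ∀ k, F (X k) = f k := by
  let T := Algebra.adjoin ℂ (Set.range f)
  have hT : IsMulCommutative T := Algebra.isMulCommutative_adjoin ℂ (by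
    rintro _ ⟨i, rfl⟩ _ ⟨j, rfl⟩; exact hf i j)
  let : CommRing T := { mul_comm := hT.is_comm.comm }
  refine ⟨T.val.comp (aeval fun k => (⟨f k, Algebra.subset_adjoin ⟨k, rfl⟩⟩ : T)), fun k => ?_⟩
  simp

theorem exists_algHom_sizeVar {R : Type} [Ring R] [Algebra ℂ R] {f : ℕ → R}
    (hf : ∀ i j, 1 ≤ i → 1 ≤ j → Commute (f i) (f j)) :
    ∃ F : SizePoly →ₐ[ℂ] R, ∀ k, 1 ≤ k → F (sizeVar k) = f k := by
  obtain ⟨F, hF⟩ := exists_algHom_of_commute (fun k => f (k + 1))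
    (fun i j => hf _ _ (by omega) (by omega))
  exact ⟨F, fun k hk => by rw [sizeVar, hF, Nat.sub_add_cancel hk]⟩

variable {R : Type} [Ring R] [Algebra ℂ R] {f : ℕ → R}

/-- The moments of the cumulants of `f` are `f`. -/
theorem moment_cumulant (hf : ∀ i j, 1 ≤ i → 1 ≤ j → Commute (f i) (f j)) {n : ℕ} (hn : 1 ≤ n) :
    coalgebraExtension (partitionSum cumulantCoeff f) n = f n := by
  obtain ⟨F, hF⟩ := exists_algHom_sizeVar hf
  have h := congrArg F (moment_cumulant_sizeVar hn)
  simp only [map_coalgebraExtension, map_partitionSum, hF n hn] at h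
  rw [← h]
  exact coalgebraExtension_congr (fun k _ => partitionSum_congr _ (fun j hj => (hF j hj).symm) k) n

/-- The cumulants of the moments of `f` are `f`. -/
theorem cumulant_moment (hf : ∀ i j, 1 ≤ i → 1 ≤ j → Commute (f i) (f j)) {n : ℕ} (hn : 1 ≤ n) :
    partitionSum cumulantCoeff (coalgebraExtension f) n = f n := by
  obtain ⟨F, hF⟩ := exists_algHom_sizeVar hf
  have h := congrArg F (cumulant_moment_sizeVar hn)
  simp only [map_coalgebraExtension, map_partitionSum, hF n hn] at h
  rw [← h]
  exact partitionSum_congr _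
    (fun k _ => coalgebraExtension_congr (fun j hj => (hF j hj).symm) k) n

/-- Only the partition into singletons contributes. In terms of the recursion, every shifted
variable evaluates to zero, so the derivation term disappears and each step multiplies by `f 1`. -/
theorem coalgebraExtension_single (f : ℕ → R) (hf : ∀ k, 2 ≤ k → f k = 0) (n : ℕ) :
    coalgebraExtension f n = f 1 ^ n := by
  obtain ⟨F, hF⟩ := exists_algHom_sizeVar (f := f) (by
    intro i j hi hj
    rcases hi.lt_or_eq with hi | rfl
    · simp [hf i hi]
    · rcases hj.lt_or_eq with hj | rfl
      · simp [hf j hj]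
      · rfl)
  have h0 : ∀ w, F (shiftDeriv w) = 0 := fun w => by
    induction w using MvPolynomial.induction_on with
    | C a => simp [shiftDeriv]
    | add u v hu hv => simp [hu, hv]
    | mul_X u k hu =>
      have : F (shiftDeriv (X k)) = 0 := by
        have := hF (k + 2) (by omega)
        simp only [sizeVar, hf (k + 2) (by omega)] at this
        simpa [shiftDeriv, mkDerivation_X] using this
      simp [Derivation.leibniz, hu, this]
  have h : F (coalgebraExtension sizeVar n) = f 1 ^ n := by
    induction n with
    | zero => simp [coalgebraExtension_zero]
    | succ n ih =>
      rw [coalgebraExtension_succ shiftDeriv (fun _ => shiftDeriv_sizeVar), map_add, map_mul, h0,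
        ih, hF 1 le_rfl, add_zero, pow_succ']
  rw [← h, map_coalgebraExtension]
  exact coalgebraExtension_congr (fun k hk => (hF k hk).symm) n

end Universal

section Transfer

open MvPolynomial

/-! ### The cumulant map on the symmetric algebra of `SizePoly` -/

/-- The symmetric algebra of the vector space `SizePoly`: polynomials in its monomials. -/
abbrev WordPoly : Type := MvPolynomial (ℕ →₀ ℕ) ℂ

/-- The inclusion of the generators. -/
def wordGen : SizePoly →ₗ[ℂ] WordPoly := (basisMonomials ℕ ℂ).constr ℂ X

theorem wordGen_monomial (m : ℕ →₀ ℕ) : wordGen (monomial m 1) = X m := by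
  have := (basisMonomials ℕ ℂ).constr_basis ℂ (X : _ → WordPoly) m
  simpa [wordGen] using this

/-- The derivation of the symmetric algebra that extends a linear map. -/
def wordDeriv (f : SizePoly →ₗ[ℂ] SizePoly) : Derivation ℂ WordPoly WordPoly :=
  mkDerivation ℂ fun m => wordGen (f (monomial m 1))

theorem wordDeriv_wordGen (f : SizePoly →ₗ[ℂ] SizePoly) (y : SizePoly) :
    wordDeriv f (wordGen y) = wordGen (f y) := by
  have h : (wordDeriv f).toLinearMap ∘ₗ wordGen = wordGen ∘ₗ f :=
    (basisMonomials ℕ ℂ).ext fun m => by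
      simp [wordGen_monomial, wordDeriv, mkDerivation_X]
  exact LinearMap.congr_fun h y

/-- Commutators of derivations are derivations, so it suffices to compare both sides on generators.
-/
theorem wordDeriv_commutator (f g : SizePoly →ₗ[ℂ] SizePoly) (w : WordPoly) :
    wordDeriv f (wordDeriv g w) - wordDeriv g (wordDeriv f w) =
      wordDeriv (f ∘ₗ g - g ∘ₗ f) w := by
  have h : ⁅wordDeriv f, wordDeriv g⁆ = wordDeriv (f ∘ₗ g - g ∘ₗ f) := by
    refine MvPolynomial.derivation_ext fun m => ?_
    rw [Derivation.commutator_apply, ← wordGen_monomial]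
    simp only [wordDeriv_wordGen, ← map_sub]
    rfl
  rw [← h, Derivation.commutator_apply]

/-- The operator on words that adds the factor `a` or multiplies it into one of the factors. -/
def wordJoin (a : SizePoly) : Module.End ℂ WordPoly :=
  LinearMap.mulLeft ℂ (wordGen a) + (wordDeriv (LinearMap.mulLeft ℂ a)).toLinearMap

theorem wordJoin_apply (a : SizePoly) (w : WordPoly) :
    wordJoin a w = wordGen a * w + wordDeriv (LinearMap.mulLeft ℂ a) w := rfl

/-- This makes the recursion of the word map independent of the order in which the factors of a
monomial are removed. -/
theorem wordJoin_commute (a b : SizePoly) : Commute (wordJoin a) (wordJoin b) := by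
  refine LinearMap.ext fun w => ?_
  have h := wordDeriv_commutator (LinearMap.mulLeft ℂ a) (LinearMap.mulLeft ℂ b) w
  have h0 : LinearMap.mulLeft ℂ a ∘ₗ LinearMap.mulLeft ℂ b -
      LinearMap.mulLeft ℂ b ∘ₗ LinearMap.mulLeft ℂ a = (0 : SizePoly →ₗ[ℂ] SizePoly) := by
    refine LinearMap.ext fun x => ?_
    simp only [LinearMap.sub_apply, LinearMap.comp_apply, LinearMap.mulLeft_apply,
      LinearMap.zero_apply]
    ring
  have h1 : wordDeriv (0 : SizePoly →ₗ[ℂ] SizePoly) = 0 :=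
    MvPolynomial.derivation_ext fun m => by simp [wordDeriv, mkDerivation_X]
  rw [h0, h1, Derivation.zero_apply, sub_eq_zero] at h
  simp only [Module.End.mul_apply, wordJoin_apply, map_add, Derivation.leibniz, h, smul_eq_mul,
    wordDeriv_wordGen, LinearMap.mulLeft_apply, mul_comm b a]
  ring

/-- The image of a word `x_{k₁} ⋯ x_{kₙ}` under the cumulant map, as a linear map. -/
theorem exists_wordMap : ∃ F : SizePoly →ₗ[ℂ] WordPoly, F 1 = 1 ∧
    ∀ k w, F (X k * w) = wordJoin (X k) (F w) := by
  obtain ⟨J, hJ⟩ := exists_algHom_of_commute (fun k : ℕ => wordJoin (X k))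
    fun i j => wordJoin_commute _ _
  exact ⟨LinearMap.applyₗ (1 : WordPoly) ∘ₗ J.toLinearMap, by simp, fun k w => by simp [hJ]⟩

/-- The universal form of the statement that `φ` turns components into moments: both sides satisfy
the recursion of `coalgebraExtension_succ`, for a suitable derivation of words. -/
theorem wordMap_coalgebraExtension {F : SizePoly →ₗ[ℂ] WordPoly} (h1 : F 1 = 1)
    (hF : ∀ k w, F (X k * w) = wordJoin (X k) (F w)) (n : ℕ) :
    F (coalgebraExtension sizeVar n) =
      coalgebraExtension (fun k => wordGen (coalgebraExtension sizeVar k)) n := by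
  have hs := coalgebraExtension_succ shiftDeriv (fun _ => shiftDeriv_sizeVar)
  have hb1 : coalgebraExtension sizeVar 1 = sizeVar 1 := by
    rw [hs]; simp [coalgebraExtension_zero]
  -- The induction over factors works because the commutator of `wordDeriv shiftDeriv` with
  -- `wordJoin (X k)` is `wordJoin (X (k + 1))`.
  have hFD (w : SizePoly) : F (shiftDeriv w) = wordDeriv shiftDeriv.toLinearMap (F w) := by
    induction w using MvPolynomial.induction_on with
    | C a =>
      have : (C a : SizePoly) = a • 1 := by rw [← C_mul', mul_one]
      simp [this, h1]
    | add u v hu hv => simp [hu, hv]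
    | mul_X u k hu =>
      have h := wordDeriv_commutator shiftDeriv.toLinearMap (LinearMap.mulLeft ℂ (X k)) (F u)
      have h' : shiftDeriv.toLinearMap ∘ₗ LinearMap.mulLeft ℂ (X k : SizePoly) -
          LinearMap.mulLeft ℂ (X k) ∘ₗ shiftDeriv.toLinearMap =
          LinearMap.mulLeft ℂ (X (k + 1)) := by
        refine LinearMap.ext fun x => ?_
        simp [Derivation.leibniz, shiftDeriv, mkDerivation_X]
        ring
      rw [h', sub_eq_iff_eq_add] at h
      have hk : shiftDeriv (X k) = X (k + 1) := by simp [shiftDeriv, mkDerivation_X]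
      rw [mul_comm u, hF, Derivation.leibniz, smul_eq_mul, smul_eq_mul, hk, map_add, hF,
        mul_comm u, hF, hu, wordJoin_apply, wordJoin_apply, wordJoin_apply, map_add, h,
        Derivation.leibniz, wordDeriv_wordGen]
      simp only [smul_eq_mul, Derivation.coeFn_coe, hk]
      ring
  -- On the generator of a moment, `D` acts by `m ↦ x₁ m + shiftDeriv m`, which is the next moment.
  -- Its first summand is the part of `wordJoin x₁` that multiplies into factors.
  let D : Derivation ℂ WordPoly WordPoly :=
    wordDeriv (LinearMap.mulLeft ℂ (sizeVar 1)) + wordDeriv shiftDeriv.toLinearMap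
  have hD : ∀ k, 1 ≤ k → D (wordGen (coalgebraExtension sizeVar k)) =
      wordGen (coalgebraExtension sizeVar (k + 1)) := fun k _ => by
    rw [hs k, map_add, Derivation.add_apply, wordDeriv_wordGen, wordDeriv_wordGen]
    rfl
  induction n with
  | zero => simp [coalgebraExtension_zero, h1]
  | succ n ih =>
    rw [coalgebraExtension_succ (f := fun k => wordGen (coalgebraExtension sizeVar k)) D hD, ← ih,
      hs n, map_add, hFD, hb1, sizeVar, hF, wordJoin_apply, Derivation.add_apply, add_assoc]
    rfl

/-! ### Cumulant maps send extensions to extensions of moments -/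

variable {R B : Type} [Ring R] [Algebra ℂ R] [Ring B] [Algebra ℂ B]

/-- A linear map `Φ` with `Φ 1 = 1` and `Φ (a ⊙ w) = a ⊙ Φ w + δ_a (Φ w)`, where `δ_a` multiplies `a`
into the factors of a word, maps the extension of `f` to that of the moments of `f`. -/
theorem map_coalgebraExtension_eq_moments (R₀ : Subalgebra ℂ R) (ι : R →ₗ[ℂ] B)
    (hR : ∀ x ∈ R₀, ∀ y ∈ R₀, Commute x y) (hι : ∀ x ∈ R₀, ∀ y ∈ R₀, Commute (ι x) (ι y))
    (Φ : B →ₗ[ℂ] B) (hΦ : Φ 1 = 1)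
    (hδ : ∀ a ∈ R₀, ∃ δ : B →ₗ[ℂ] B, δ 1 = 0 ∧
      (∀ z ∈ R₀, ∀ w, δ (ι z * w) = ι (a * z) * w + ι z * δ w) ∧
      ∀ w, Φ (ι a * w) = ι a * Φ w + δ (Φ w))
    {f : ℕ → R} (hf : ∀ k, 1 ≤ k → f k ∈ R₀) (n : ℕ) :
    Φ (coalgebraExtension (fun k => ι (f k)) n) =
      coalgebraExtension (fun k => ι (coalgebraExtension f k)) n := by
  obtain ⟨ev, hev⟩ := exists_algHom_sizeVar (f := f)
    fun i j hi hj => hR _ (hf i hi) _ (hf j hj)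
  have hX (k : ℕ) : ev (X k) = f (k + 1) := hev (k + 1) (by omega)
  have hmem (w : SizePoly) : ev w ∈ R₀ := by
    induction w using MvPolynomial.induction_on with
    | C a => rw [← algebraMap_eq, AlgHom.commutes]; exact R₀.algebraMap_mem a
    | add u v hu hv => rw [map_add]; exact R₀.add_mem hu hv
    | mul_X u k hu => rw [map_mul, hX]; exact R₀.mul_mem hu (hf _ (by omega))
  obtain ⟨ρ, hρ⟩ := exists_algHom_sizeVar (f := fun k => ι (f k))
    fun i j hi hj => hι _ (hf i hi) _ (hf j hj)
  have hρX (k : ℕ) : ρ (X k) = ι (f (k + 1)) := hρ (k + 1) (by omega)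
  -- A monomial is a single letter of `WordPoly`; `τ` first evaluates it in `R₀` and then includes
  -- the result as a generator. The aim is `Φ ∘ ρ = τ ∘ F`, which transports the universal identity.
  obtain ⟨τ, hτ⟩ := exists_algHom_of_commute (fun m : ℕ →₀ ℕ => ι (ev (monomial m 1)))
    fun i j => hι _ (hmem _) _ (hmem _)
  have hτg (y : SizePoly) : τ (wordGen y) = ι (ev y) := by
    have h : τ.toLinearMap ∘ₗ wordGen = ι ∘ₗ ev.toLinearMap :=
      (basisMonomials ℕ ℂ).ext fun m => by simp [wordGen_monomial, hτ]
    exact LinearMap.congr_fun h y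
  obtain ⟨F, h1, hF⟩ := exists_wordMap
  have hΦF (w : SizePoly) : Φ (ρ w) = τ (F w) := by
    induction w using MvPolynomial.induction_on with
    | C a =>
      have : (C a : SizePoly) = a • 1 := by rw [← C_mul', mul_one]
      simp [this, h1, hΦ]
    | add u v hu hv => simp [hu, hv]
    | mul_X u k hu =>
      obtain ⟨δ, hδ1, hδz, hδΦ⟩ := hδ (f (k + 1)) (hf _ (by omega))
      have hd (v : WordPoly) : δ (τ v) = τ (wordDeriv (LinearMap.mulLeft ℂ (X k)) v) := by
        induction v using MvPolynomial.induction_on with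
        | C a =>
          have : (C a : WordPoly) = a • 1 := by rw [← C_mul', mul_one]
          simp [this, hδ1]
        | add u v hu hv => simp [hu, hv]
        | mul_X v m hv =>
          have h2 := hδz _ (hmem (monomial m 1)) (τ v)
          rw [← hX, ← map_mul, ← hτg, ← hτg, hv] at h2
          rw [mul_comm v, Derivation.leibniz, ← wordGen_monomial, wordDeriv_wordGen, map_mul, h2,
            smul_eq_mul, smul_eq_mul, mul_comm v, map_add, map_mul τ, map_mul τ, add_comm]
          rfl
      rw [mul_comm u, map_mul, hρX, hδΦ, hF, hu, hd, wordJoin_apply, map_add, map_mul, hτg, hX]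
  have h := hΦF (coalgebraExtension sizeVar n)
  rw [wordMap_coalgebraExtension h1 hF, map_coalgebraExtension, map_coalgebraExtension] at h
  simp only [hτg, map_coalgebraExtension] at h
  rw [coalgebraExtension_congr hρ n] at h
  rw [h]
  exact coalgebraExtension_congr (fun k _ => by rw [coalgebraExtension_congr hev k]) n

end Transfer

/-! ### Degrees, derivations and word length in the symmetric algebra -/

section SymDegree

variable {M : Type} [AddCommGroup M] [Module ℂ M] {ℳ : ℤ → Submodule ℂ M}

/-- A linear map on `S M` shifts degrees by `j` if it does so on products of generators. -/
theorem mem_grading_of_prod {F : Sym ℳ →ₗ[ℂ] Sym ℳ} {j : ℤ}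
    (h : ∀ l : List (Σ i, ℳ i), F (l.map fun a => Sym.ι ℳ (a.2 : M)).prod ∈
      Sym.grading ℳ ((l.map Sigma.fst).sum + j)) {n : ℤ} {w : Sym ℳ} (hw : w ∈ Sym.grading ℳ n) :
    F w ∈ Sym.grading ℳ (n + j) := by
  have : Sym.grading ℳ n ≤ (Sym.grading ℳ (n + j)).comap F := by
    refine Submodule.span_le.2 ?_
    rintro _ ⟨l, rfl, rfl⟩
    exact h l
  exact this hw

theorem list_prod_mem_grading (l : List (Σ i, ℳ i)) :
    (l.map fun a => Sym.ι ℳ (a.2 : M)).prod ∈ Sym.grading ℳ (l.map Sigma.fst).sum :=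
  Submodule.subset_span ⟨l, rfl, rfl⟩

theorem derivation_mem_grading [DirectSum.Decomposition ℳ] (f : M →ₗ[ℂ] M) (j : ℤ)
    (hf : ∀ i, ∀ a ∈ ℳ i, f a ∈ ℳ (i + j)) {n : ℤ} {w : Sym ℳ} (hw : w ∈ Sym.grading ℳ n) :
    Sym.derivation f j hf w ∈ Sym.grading ℳ (n + j) := by
  refine mem_grading_of_prod (fun l => ?_) hw
  induction l with
  | nil => simp [Sym.derivation_one]
  | cons a l ih =>
    rw [List.map_cons, List.map_cons, List.prod_cons, Sym.derivation_mul,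
      signTwist_apply _ a.2.2, map_smul, smul_mul_assoc, List.sum_cons]
    refine Submodule.add_mem _ ?_ (Submodule.smul_mem _ _ ?_)
    · rw [add_right_comm]
      exact SetLike.mul_mem_graded (Sym.ι_mem (hf _ _ a.2.2)) (list_prod_mem_grading l)
    · rw [add_assoc]
      exact SetLike.mul_mem_graded (Sym.ι_mem a.2.2) ih

theorem derivation_prod_eq_zero [DirectSum.Decomposition ℳ] (f : M →ₗ[ℂ] M) (j : ℤ)
    (hf : ∀ i, ∀ a ∈ ℳ i, f a ∈ ℳ (i + j)) (l : List M) (hl : ∀ a ∈ l, f a = 0) :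
    Sym.derivation f j hf (l.map (Sym.ι ℳ)).prod = 0 := by
  induction l with
  | nil => simp [Sym.derivation_one]
  | cons a l ih =>
    rw [List.map_cons, List.prod_cons, Sym.derivation_mul, hl a (by simp),
      ih fun b hb => hl b (by simp [hb])]
    simp

/-- The derivation that extends `f` kills every extension of a sequence of `f`-closed elements. -/
theorem derivation_coalgebraExtension [DirectSum.Decomposition ℳ] (f : M →ₗ[ℂ] M) (j : ℤ)
    (hf : ∀ i, ∀ a ∈ ℳ i, f a ∈ ℳ (i + j)) {X : ℕ → M} (hX : ∀ k, f (X k) = 0) (n : ℕ) :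
    Sym.derivation f j hf (coalgebraExtension (fun k => Sym.ι ℳ (X k)) n) = 0 := by
  rw [coalgebraExtension, map_sum]
  refine Finset.sum_eq_zero fun π _ => ?_
  have := derivation_prod_eq_zero f j hf (List.ofFn fun i => X (π.partSize i)) (by simp [hX])
  simpa [List.map_ofFn, Function.comp_def] using this

/-- The augmentation of `S M`. -/
def symAug (ℳ : ℤ → Submodule ℂ M) : Sym ℳ →ₐ[ℂ] ℂ := Sym.lift ℳ 0 (by simp)

/-- In the action that defines `wordProj`, the generator `a` sends `(c, m)` to `(0, c • a)`. Hence
it sees only the first coordinate of `w` applied to `(1, 0)`, which is the augmentation of `w`. -/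
theorem wordProj_ι_mul (a : M) (w : Sym ℳ) :
    Sym.wordProj ℳ (Sym.ι ℳ a * w) = symAug ℳ w • a := by
  have h (w : Sym ℳ) : (Sym.lift ℳ (A := Module.End ℂ (ℂ × M))
      { toFun := fun a => LinearMap.inr ℂ ℂ M ∘ₗ LinearMap.toSpanSingleton ℂ M a ∘ₗ
          LinearMap.fst ℂ ℂ M
        map_add' := fun a b => by ext <;> simp
        map_smul' := fun c a => by ext <;> simp }
      (fun i j a b _ _ => by ext <;> simp) w (1, 0)).1 = symAug ℳ w := by
    induction w using Sym.induction with
    | one => simp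
    | smul c w hw => simp [hw]
    | add u v hu hv => simp [hu, hv]
    | mul a w hw => simp [symAug]
  simp only [Sym.wordProj, LinearMap.comp_apply, AlgHom.toLinearMap_apply, map_mul, Sym.lift_ι]
  simp [h]

theorem wordProj_one : Sym.wordProj ℳ 1 = 0 := by simp [Sym.wordProj]

theorem constantCoeff_shiftDeriv (w : SizePoly) :
    MvPolynomial.constantCoeff (shiftDeriv w) = 0 := by
  induction w using MvPolynomial.induction_on with
  | C a => simp
  | add u v hu hv => simp [hu, hv]
  | mul_X u k hu => simp [Derivation.leibniz, shiftDeriv, MvPolynomial.mkDerivation_X]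

/-- The components of the coalgebra map with components `X n` are the `X n`. -/
theorem wordProj_coalgebraExtension (X : ℕ → M)
    (hX : ∀ i j, Commute (Sym.ι ℳ (X i)) (Sym.ι ℳ (X j))) {n : ℕ} (hn : 1 ≤ n) :
    Sym.wordProj ℳ (coalgebraExtension (fun k => Sym.ι ℳ (X k)) n) = X n := by
  -- The offset `r` is carried along because, under the projection to words of length one,
  -- `shiftDeriv` amounts to raising `r` by one. The products with `x₁` in the recursion then
  -- project to zero, apart from the initial one.
  have hshift : ∀ r, ∃ F : SizePoly →ₐ[ℂ] Sym ℳ,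
      ∀ k, 1 ≤ k → F (sizeVar k) = Sym.ι ℳ (X (k + r)) := fun r =>
    exists_algHom_sizeVar (f := fun k => Sym.ι ℳ (X (k + r))) fun i j _ _ => hX _ _
  choose F hF using hshift
  have hFX (r k : ℕ) : F r (MvPolynomial.X k) = Sym.ι ℳ (X (k + 1 + r)) :=
    hF r (k + 1) (by omega)
  have haug (r : ℕ) (w : SizePoly) : symAug ℳ (F r w) = MvPolynomial.constantCoeff w := by
    induction w using MvPolynomial.induction_on with
    | C a => rw [← MvPolynomial.algebraMap_eq]; simp
    | add u v hu hv => simp [hu, hv]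
    | mul_X u k hu => simp [hFX, symAug]
  have hD (r : ℕ) (w : SizePoly) : Sym.wordProj ℳ (F r (shiftDeriv w)) =
      Sym.wordProj ℳ (F (r + 1) w) := by
    induction w using MvPolynomial.induction_on with
    | C a =>
      have : (MvPolynomial.C a : SizePoly) = a • 1 := by rw [← MvPolynomial.C_mul', mul_one]
      simp [this, wordProj_one]
    | add u v hu hv => simp [hu, hv]
    | mul_X u k hu =>
      have hk : shiftDeriv (MvPolynomial.X k) = MvPolynomial.X (k + 1) := by
        simp [shiftDeriv, MvPolynomial.mkDerivation_X]
      rw [mul_comm, Derivation.leibniz, smul_eq_mul, smul_eq_mul, hk, mul_comm u]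
      simp only [map_add, map_mul (F _), hFX, wordProj_ι_mul, haug, constantCoeff_shiftDeriv,
        zero_smul, zero_add]
      rw [add_right_comm (k + 1), add_assoc]
  have hs := coalgebraExtension_succ shiftDeriv (fun _ => shiftDeriv_sizeVar)
  have hc (n : ℕ) : MvPolynomial.constantCoeff (coalgebraExtension sizeVar (n + 1)) = 0 := by
    simp [hs, constantCoeff_shiftDeriv, sizeVar]
  have key (n : ℕ) : ∀ r, Sym.wordProj ℳ (F r (coalgebraExtension sizeVar (n + 1))) =
      X (n + 1 + r) := by
    induction n with
    | zero =>
      intro r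
      rw [hs, coalgebraExtension_zero]
      simp only [Derivation.map_one_eq_zero, add_zero, map_mul, map_one, hF r 1 le_rfl,
        wordProj_ι_mul, one_smul]
    | succ n ih =>
      intro r
      rw [hs, map_add, map_add, hD, ih, map_mul, hF r 1 le_rfl, wordProj_ι_mul, haug, hc,
        zero_smul, zero_add]
      congr 1; omega
  obtain ⟨m, rfl⟩ := Nat.exists_eq_add_of_le' hn
  have := key m 0
  rw [map_coalgebraExtension, coalgebraExtension_congr (hF 0)] at this
  exact this

end SymDegree

/-! ### The cumulant map on extensions of degree zero sequences -/

section SymCumulant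

variable {A : Type} [Ring A] [Algebra ℂ A] {𝒜 : ℤ → Submodule ℂ A} [GradedAlgebra 𝒜]

theorem join_mem_grading {i n : ℤ} {a : A} (ha : a ∈ 𝒜 i) {w : Sym 𝒜}
    (hw : w ∈ Sym.grading 𝒜 n) : join 𝒜 a w ∈ Sym.grading 𝒜 (i + n) := by
  rw [join_apply ha]
  refine Submodule.add_mem _ (SetLike.mul_mem_graded (Sym.ι_mem ha) hw) ?_
  rw [add_comm]
  exact derivation_mem_grading _ _ _ hw

theorem commute_ι_of_degree_zero {x y : A} (hx : x ∈ 𝒜 0) (hy : y ∈ 𝒜 0) :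
    Commute (Sym.ι 𝒜 x) (Sym.ι 𝒜 y) := by
  simpa [Commute, SemiconjBy] using Sym.ι_swap (ℳ := 𝒜) hx hy

variable [GradedCommutative 𝒜]

theorem cumulantHom_mem_grading {n : ℤ} {w : Sym 𝒜} (hw : w ∈ Sym.grading 𝒜 n) :
    cumulantHom 𝒜 w ∈ Sym.grading 𝒜 n := by
  rw [← add_zero n]
  refine mem_grading_of_prod (fun l => ?_) hw
  rw [add_zero]
  induction l with
  | nil => simpa [cumulantHom_one] using SetLike.GradedOne.one_mem (A := Sym.grading 𝒜)
  | cons a l ih =>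
    rw [List.map_cons, List.map_cons, List.prod_cons, cumulantHom_mul, List.sum_cons]
    exact join_mem_grading a.2.2 ih

theorem commute_of_degree_zero {x y : A} (hx : x ∈ 𝒜 0) (hy : y ∈ 𝒜 0) : Commute x y := by
  simpa [Commute, SemiconjBy] using GradedCommutative.mul_swap (𝒜 := 𝒜) 0 0 x y hx hy

/-- The transfer principle applies with the degree zero part of `A` as `R₀`: the Koszul signs are
trivial there, and `δ` is the derivation extending multiplication by `a`. -/
theorem cumulantHom_coalgebraExtension {f : ℕ → A} (hf : ∀ k, 1 ≤ k → f k ∈ 𝒜 0) (n : ℕ) :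
    cumulantHom 𝒜 (coalgebraExtension (fun k => Sym.ι 𝒜 (f k)) n) =
      coalgebraExtension (fun k => Sym.ι 𝒜 (coalgebraExtension f k)) n := by
  refine map_coalgebraExtension_eq_moments (SetLike.GradeZero.subalgebra 𝒜) (Sym.ι 𝒜)
    (fun x hx y hy => commute_of_degree_zero hx hy)
    (fun x hx y hy => commute_ι_of_degree_zero hx hy)
    (cumulantHom 𝒜) (cumulantHom_one 𝒜) (fun a ha => ?_) hf n
  refine ⟨Sym.derivation (LinearMap.mulLeft ℂ a) 0 (mulLeft_degree 𝒜 ha),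
    Sym.derivation_one _ _ _, fun z hz w => ?_, fun w => ?_⟩
  · rw [Sym.derivation_mul, signTwist_apply _ hz]
    simp
  · rw [cumulantHom_mul, join_apply ha]

end SymCumulant

/-! ### Expectation, primitives and cumulants in the homotopy Gaussian -/

section Gaussian

open Polynomial

theorem integral_gauss_ne_zero : (∫ x : ℝ, (Real.exp (-x ^ 2 / 2) : ℂ)) ≠ 0 := by
  have h : ∫ x : ℝ, (Real.exp (-x ^ 2 / 2) : ℂ) =
      ((∫ x : ℝ, Real.exp (-(1 / 2) * x ^ 2) : ℝ) : ℂ) := by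
    rw [← integral_complex_ofReal]
    refine MeasureTheory.integral_congr_ae (MeasureTheory.ae_of_all _ fun x => ?_)
    simp only
    congr 2
    ring
  rw [h, integral_gaussian]
  norm_cast
  positivity

theorem expectation_C (c : ℂ) : expectation (TrivSqZeroExt.inl (C c)) = c := by
  simp only [expectation, LinearMap.coe_mk, AddHom.coe_mk, TrivSqZeroExt.fst_inl, eval_C,
    MeasureTheory.integral_const_mul]
  exact mul_div_cancel_right₀ c integral_gauss_ne_zero

/-- The integrand `(q' - x q) e^{-x²/2}` is the derivative of the integrable function `q e^{-x²/2}`.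
-/
theorem expectation_diff (v : GaussV) : expectation (diff v) = 0 := by
  obtain ⟨q, hq⟩ : ∃ q, v.snd = q := ⟨_, rfl⟩
  have h1 (x : ℝ) : HasDerivAt (fun x : ℝ => q.eval (x : ℂ) * (Real.exp (-x ^ 2 / 2) : ℂ))
      ((derivative q - X * q).eval (x : ℂ) * (Real.exp (-x ^ 2 / 2) : ℂ)) x := by
    have hp : HasDerivAt (fun x : ℝ => q.eval (x : ℂ)) ((derivative q).eval (x : ℂ)) x :=
      (q.hasDerivAt (x : ℂ)).comp_ofReal
    have he : HasDerivAt (fun x : ℝ => Real.exp (-x ^ 2 / 2)) (Real.exp (-x ^ 2 / 2) * (-x)) x := by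
      refine HasDerivAt.exp ?_
      have := ((hasDerivAt_pow 2 x).neg).div_const 2
      convert! this using 1
      simp only [Nat.cast_ofNat]
      ring
    convert! hp.mul he.ofReal_comp using 1
    simp only [eval_sub, eval_mul, eval_X, Complex.ofReal_mul, Complex.ofReal_neg]
    ring
  have h := MeasureTheory.integral_eq_zero_of_hasDerivAt_of_integrable h1 (integrable_aux _)
    (integrable_aux _)
  simp only [expectation, diff, LinearMap.coe_mk, AddHom.coe_mk, TrivSqZeroExt.fst_inl, hq, h,
    zero_div]

/-- The sum telescopes: the derivative of each summand is cancelled by `X` times the next one, and a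
single lower power remains. -/
theorem gaussY_partial_sum {n : ℕ} (m : ℕ) (hm : 1 ≤ m) (hmn : 2 * m ≤ n + 1) :
    X * (∑ j ∈ Finset.Icc 1 m, C (((n - 1)‼ : ℂ) / ((n + 1 - 2 * j)‼ : ℂ)) * X ^ (n + 1 - 2 * j)) -
      derivative (∑ j ∈ Finset.Icc 1 m,
        C (((n - 1)‼ : ℂ) / ((n + 1 - 2 * j)‼ : ℂ)) * X ^ (n + 1 - 2 * j)) =
    X ^ n - C (((n - 1)‼ : ℂ) / ((n + 1 - 2 * m)‼ : ℂ) * ((n + 1 - 2 * m : ℕ) : ℂ)) *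
      X ^ (n - 2 * m) := by
  induction m, hm using Nat.le_induction with
  | base =>
    obtain ⟨k, rfl⟩ : ∃ k, n = k + 1 := ⟨n - 1, by omega⟩
    have : ((k‼ : ℕ) : ℂ) ≠ 0 := by exact_mod_cast (Nat.doubleFactorial_pos k).ne'
    simp [div_self this, derivative_X_pow, pow_succ', show k + 1 - 2 = k - 1 by omega]
  | succ m hm ih =>
    obtain ⟨k, rfl⟩ : ∃ k, n = k + 2 * m + 1 := ⟨n - (2 * m + 1), by omega⟩
    rw [Finset.sum_Icc_succ_top (by omega), mul_add, derivative_add, add_sub_add_comm,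
      ih (by omega)]
    rw [show k + 2 * m + 1 + 1 - 2 * m = k + 2 by omega,
      show k + 2 * m + 1 - 2 * m = k + 1 by omega,
      show k + 2 * m + 1 + 1 - 2 * (m + 1) = k by omega,
      show k + 2 * m + 1 - 2 * (m + 1) = k - 1 by omega]
    have h1 : ((k‼ : ℕ) : ℂ) ≠ 0 := by exact_mod_cast (Nat.doubleFactorial_pos k).ne'
    have h2 : ((k + 2 : ℕ) : ℂ) ≠ 0 := by exact_mod_cast (by omega : k + 2 ≠ 0)
    -- The remainder so far has coefficient `(n-1)‼ (k+2) / (k+2)‼`, which is exactly the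
    -- coefficient of the new summand.
    have h3 (a : ℂ) : a / (((k + 2)‼ : ℕ) : ℂ) * ((k + 2 : ℕ) : ℂ) = a / (k‼ : ℂ) := by
      rw [Nat.doubleFactorial_add_two, Nat.cast_mul]
      field_simp
    rw [h3, derivative_C_mul, derivative_X_pow, C_mul (b := (k : ℂ)), pow_succ']
    ring

/-- `d yₙ = xⁿ - c` for a constant `c`. -/
theorem exists_diff_gaussY {n : ℕ} (hn : 1 ≤ n) :
    ∃ c : ℂ, diff (gaussY n) = TrivSqZeroExt.inl (X ^ n - C c) := by
  have h := gaussY_partial_sum (n := n) ((n + 1) / 2) (by omega) (by omega)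
  -- For even `n` the remaining power is genuinely zero. For odd `n` it is zero by truncated
  -- subtraction, and then the coefficient vanishes too.
  rw [show n - 2 * ((n + 1) / 2) = 0 by omega, pow_zero, mul_one] at h
  obtain ⟨c, hc⟩ : ∃ c : ℂ, _ = X ^ n - C c := ⟨_, h⟩
  refine ⟨c, ?_⟩
  rw [← hc]
  simp only [diff, gaussY, LinearMap.coe_mk, AddHom.coe_mk, TrivSqZeroExt.snd_neg,
    TrivSqZeroExt.snd_inr, derivative_neg]
  congr 1
  ring

/-- The constants in `d yₙ = xⁿ - c` need not be computed. Together they give `d h(r) = r - c`, and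
taking expectations forces `c = 0`, since `E d = 0` and `E(r) = 0`. -/
theorem diff_gaussH {r : ℂ[X]} (hr : expectation (TrivSqZeroExt.inl r) = 0) :
    diff (gaussH r) = TrivSqZeroExt.inl r := by
  have h1 : ∃ c : ℂ, diff (gaussH r) = TrivSqZeroExt.inl (r - C c) := by
    have h : ∀ i, ∃ c : ℂ, 1 ≤ i → diff (gaussY i) = TrivSqZeroExt.inl (X ^ i - C c) := fun i => by
      by_cases hi : 1 ≤ i
      · obtain ⟨c, hc⟩ := exists_diff_gaussY hi
        exact ⟨c, fun _ => hc⟩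
      · exact ⟨0, fun h => absurd h hi⟩
    choose c hc using h
    refine ⟨r.coeff 0 + ∑ i ∈ Finset.Icc 1 r.natDegree, r.coeff i * c i, ?_⟩
    have h2 : r = C (r.coeff 0) + ∑ i ∈ Finset.Icc 1 r.natDegree, r.coeff i • X ^ i := by
      conv_lhs => rw [r.as_sum_range_C_mul_X_pow, Finset.range_eq_Ico,
        Finset.sum_eq_sum_Ico_succ_bot (by omega)]
      simp only [pow_zero, mul_one, zero_add, smul_eq_C_mul]
      rfl
    have h3 : r - C (r.coeff 0 + ∑ i ∈ Finset.Icc 1 r.natDegree, r.coeff i * c i) =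
        ∑ i ∈ Finset.Icc 1 r.natDegree, r.coeff i • (X ^ i - C (c i)) := by
      conv_lhs => enter [1]; rw [h2]
      simp only [smul_sub, Finset.sum_sub_distrib, C_add, map_sum, C_mul, smul_eq_C_mul]
      ring
    rw [h3, gaussH, map_sum, ← TrivSqZeroExt.inlHom_apply ℂ[X] ℂ[X], map_sum]
    refine Finset.sum_congr rfl fun i hi => ?_
    rw [map_smul, hc i (Finset.mem_Icc.1 hi).1]
    exact (TrivSqZeroExt.ext (by simp) (by simp))
  obtain ⟨c, hc⟩ := h1
  have h2 := expectation_diff (gaussH r)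
  rw [hc, TrivSqZeroExt.inl_sub, map_sub, hr, expectation_C, zero_sub, neg_eq_zero] at h2
  rw [hc, h2, C_0, sub_zero]

theorem inl_mem_gaussGrading (p : ℂ[X]) : (TrivSqZeroExt.inl p : GaussV) ∈ gaussGrading 0 :=
  ⟨fun h => absurd rfl h, fun _ => by simp⟩

theorem ordinaryVariable_mem (p : ℂ[X]) (n : ℕ) : ordinaryVariable p n ∈ gaussGrading 0 := by
  rw [ordinaryVariable]
  split
  · exact inl_mem_gaussGrading p
  · exact zero_mem _

theorem coalgebraExtension_ordinaryVariable (p : ℂ[X]) (n : ℕ) :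
    coalgebraExtension (ordinaryVariable p) n = TrivSqZeroExt.inl (p ^ n) := by
  rw [coalgebraExtension_single _ (fun k hk => by
    rw [ordinaryVariable, if_neg (by omega)]), ordinaryVariable, if_pos rfl,
    TrivSqZeroExt.inl_pow]

theorem cumulantHom_ordinaryVariable (p : ℂ[X]) (n : ℕ) :
    cumulantHom gaussGrading
        (coalgebraExtension (fun k => Sym.ι gaussGrading (ordinaryVariable p k)) n) =
      coalgebraExtension (fun k => Sym.ι gaussGrading (TrivSqZeroExt.inl (p ^ k))) n := by
  rw [cumulantHom_coalgebraExtension fun k _ => ordinaryVariable_mem p k]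
  simp only [coalgebraExtension_ordinaryVariable]

/-- After `φ` the components are the powers `p ^ k`, and `d` vanishes on polynomials in `x`. -/
theorem isLInfMorphism_ordinaryVariable (p : ℂ[X]) :
    IsLInfMorphism gaussTransported (ordinaryVariable p) where
  degree_zero n _ := ordinaryVariable_mem p n
  closed n _ := by
    have h := cumulantHom_ordinaryVariable p n
    have h2 : ∀ k, diff (TrivSqZeroExt.inl (p ^ k)) = 0 := fun k => by simp [diff]
    simp only [gaussTransported, transported, LinearMap.comp_apply, LinearEquiv.coe_coe]
    rw [cumulantMap, LinearEquiv.ofBijective_apply, h,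
      derivation_coalgebraExtension _ _ _ h2, map_zero]

theorem mem_trivialGrading_zero (a : ℂ) : a ∈ trivialGrading 0 := by simp [trivialGrading]

/-- The cumulants of an ordinary random variable, in terms of its moments. -/
theorem gaussCumulant_ordinaryVariable (p : ℂ[X]) {n : ℕ} (hn : 1 ≤ n) :
    gaussCumulant (ordinaryVariable p) n =
      partitionSum cumulantCoeff (fun k => expectation (TrivSqZeroExt.inl (p ^ k))) n := by
  -- Inverting `φ` on `S ℂ` is avoided by exhibiting the preimage: the extension of the formal
  -- cumulants is mapped by `φ` to the extension of the moments.
  have h1 : (cumulantMap trivialGrading)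
      (coalgebraExtension (fun k => Sym.ι trivialGrading (partitionSum cumulantCoeff
        (fun k => expectation (TrivSqZeroExt.inl (p ^ k))) k)) n) =
      Sym.map gaussGrading trivialGrading expectation expectation_degree
        (coalgebraExtension (fun k => Sym.ι gaussGrading (TrivSqZeroExt.inl (p ^ k))) n) := by
    rw [cumulantMap, LinearEquiv.ofBijective_apply,
      cumulantHom_coalgebraExtension fun k _ => mem_trivialGrading_zero _, map_coalgebraExtension]
    refine coalgebraExtension_congr (fun k hk => ?_) n
    rw [moment_cumulant (fun _ _ _ _ => Commute.all _ _) hk]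
    simp [Sym.map]
  simp only [gaussCumulant, cumulant, totalCumulant, LinearMap.comp_apply, LinearEquiv.coe_coe,
    AlgHom.toLinearMap_apply]
  rw [show (cumulantMap gaussGrading) (coalgebraExtension (fun k =>
      Sym.ι gaussGrading (ordinaryVariable p k)) n) = _ from cumulantHom_ordinaryVariable p n,
    ← h1, LinearEquiv.symm_apply_apply]
  exact wordProj_coalgebraExtension _ (fun i j => commute_ι_of_degree_zero
    (mem_trivialGrading_zero _) (mem_trivialGrading_zero _)) hn

theorem expectation_pow_eq_of_cumulants {p q : ℂ[X]}
    (hκ : ∀ n : ℕ, 1 ≤ n →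
      gaussCumulant (ordinaryVariable p) n = gaussCumulant (ordinaryVariable q) n)
    {n : ℕ} (hn : 1 ≤ n) :
    expectation (TrivSqZeroExt.inl (p ^ n)) = expectation (TrivSqZeroExt.inl (q ^ n)) := by
  have h (p : ℂ[X]) := moment_cumulant
    (f := fun k => expectation (TrivSqZeroExt.inl (p ^ k))) (fun _ _ _ _ => Commute.all _ _) hn
  rw [← h p, ← h q]
  refine coalgebraExtension_congr (fun k hk => ?_) n
  rw [← gaussCumulant_ordinaryVariable p hk, ← gaussCumulant_ordinaryVariable q hk, hκ k hk]

end Gaussian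

/-! ### Parity of Koszul exponents -/

section Signs

theorem neg_one_zpow_eq {m n : ℤ} (h : Even (m - n)) : (-1 : ℂ) ^ m = (-1 : ℂ) ^ n := by
  rw [← sub_add_cancel m n, zpow_add₀ (by norm_num), h.neg_one_zpow, one_mul]

theorem neg_one_zpow_mul (m n : ℤ) : (-1 : ℂ) ^ m * (-1 : ℂ) ^ n = (-1 : ℂ) ^ (m + n) :=
  (zpow_add₀ (by norm_num) m n).symm

end Signs

/-! ### Total degree zero forms and the transported differential -/

section Forms

open GradedTensorProduct

variable {A : Type} [Ring A] [Algebra ℂ A] {𝒜 : ℤ → Submodule ℂ A} [GradedAlgebra 𝒜]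

theorem forms_tmul_mul {j i : ℤ} (a : A) {ω : DualNumber ℂ[X]} (hω : ω ∈ dualGrading 1 j)
    {b : A} (hb : b ∈ 𝒜 i) (τ : DualNumber ℂ[X]) :
    (tmul ℂ a ω * tmul ℂ b τ : FormsIn 𝒜) = (-1 : ℂ) ^ (j * i) • tmul ℂ (a * b) (ω * τ) := by
  have h := tmul_coe_mul_coe_tmul (R := ℂ) 𝒜 (dualGrading 1) a ⟨ω, hω⟩ ⟨b, hb⟩ τ
  refine h.trans ?_
  rcases Int.even_or_odd (j * i) with he | ho
  · rw [he.neg_one_zpow, he.neg_one_zpow, one_smul, one_smul]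
  · rw [ho.neg_one_zpow, ho.neg_one_zpow, neg_smul, one_smul, Units.neg_smul, one_smul]

theorem forms_hom_ext {N : Type} [AddCommGroup N] [Module ℂ N] {F G : FormsIn 𝒜 →ₗ[ℂ] N}
    (h : ∀ i, ∀ u ∈ 𝒜 i, ∀ τ, F (tmul ℂ u τ) = G (tmul ℂ u τ)) : F = G := by
  refine GradedTensorProduct.hom_ext 𝒜 (dualGrading 1) (TensorProduct.ext' fun u τ => ?_)
  change F (tmul ℂ u τ) = G (tmul ℂ u τ)
  induction u using DirectSum.Decomposition.inductionOn 𝒜 with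
  | zero => simp [tmul]
  | homogeneous a => exact h _ _ a.2 τ
  | add a b ha hb =>
    simp only [tmul, TensorProduct.add_tmul, map_add] at ha hb ⊢
    rw [ha, hb]

theorem forms_tmul_smul (a : A) (c : ℂ) (ω : DualNumber ℂ[X]) :
    (tmul ℂ (c • a) ω : FormsIn 𝒜) = c • tmul ℂ a ω :=
  congrArg (GradedTensorProduct.of ℂ 𝒜 (dualGrading 1)) (TensorProduct.smul_tmul' c a ω).symm

theorem forms_tmul_smul_right (a : A) (c : ℂ) (ω : DualNumber ℂ[X]) :
    (tmul ℂ a (c • ω) : FormsIn 𝒜) = c • tmul ℂ a ω :=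
  congrArg (GradedTensorProduct.of ℂ 𝒜 (dualGrading 1)) (TensorProduct.tmul_smul c a ω)

/-- Left multiplication on `A ⊗ ℂ[t, dt]`. -/
def formsMul (x : FormsIn 𝒜) : FormsIn 𝒜 →ₗ[ℂ] FormsIn 𝒜 := mulHom 𝒜 (dualGrading 1) x

theorem formsMul_apply (x y : FormsIn 𝒜) : formsMul x y = x * y := rfl

theorem forms_smul_mul (c : ℂ) (x y : FormsIn 𝒜) : (c • x) * y = c • (x * y) := by
  rw [← formsMul_apply, formsMul, map_smul]
  rfl

theorem forms_mul_smul (c : ℂ) (x y : FormsIn 𝒜) : x * (c • y) = c • (x * y) :=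
  (formsMul x).map_smul c y

theorem forms_add_tmul (a b : A) (ω : DualNumber ℂ[X]) :
    (tmul ℂ (a + b) ω : FormsIn 𝒜) = tmul ℂ a ω + tmul ℂ b ω := by
  rw [tmul, TensorProduct.add_tmul, map_add]

theorem forms_tmul_add (a : A) (ω τ : DualNumber ℂ[X]) :
    (tmul ℂ a (ω + τ) : FormsIn 𝒜) = tmul ℂ a ω + tmul ℂ a τ := by
  rw [tmul, TensorProduct.tmul_add, map_add]

theorem formsι_tmul (a : A) (ω : DualNumber ℂ[X]) :
    formsι 𝒜 (tmul ℂ a ω) = tmul ℂ (Sym.ι 𝒜 a) ω := rfl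

/-- `T ⊗ 1` on `A ⊗ ℂ[t, dt]`. -/
def formsMap (T : A →ₗ[ℂ] A) : FormsIn 𝒜 →ₗ[ℂ] FormsIn 𝒜 :=
  (GradedTensorProduct.of ℂ 𝒜 (dualGrading 1)).toLinearMap ∘ₗ
    TensorProduct.map T LinearMap.id ∘ₗ
    (GradedTensorProduct.of ℂ 𝒜 (dualGrading 1)).symm.toLinearMap

theorem formsMap_tmul (T : A →ₗ[ℂ] A) (a : A) (ω : DualNumber ℂ[X]) :
    formsMap T (tmul ℂ a ω : FormsIn 𝒜) = tmul ℂ (T a) ω := rfl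

theorem formsMap_one {T : A →ₗ[ℂ] A} (h : T 1 = 1) : formsMap T (1 : FormsIn 𝒜) = 1 := by
  change formsMap T (tmul ℂ 1 1 : FormsIn 𝒜) = tmul ℂ 1 1
  rw [formsMap_tmul, h]

theorem tmul_mem_formsDegree {i j n : ℤ} (h : i + j = n) {a : A} (ha : a ∈ 𝒜 i)
    {ω : DualNumber ℂ[X]} (hω : ω ∈ dualGrading 1 j) :
    (tmul ℂ a ω : FormsIn 𝒜) ∈ formsDegree 𝒜 n :=
  Submodule.subset_span ⟨i, j, h, a, ha, ω, hω, rfl⟩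

variable (𝒜) in
/-- The subalgebra of `A ⊗ ℂ[t, dt]` of total degree zero. -/
def formsZero : Subalgebra ℂ (FormsIn 𝒜) :=
  (formsDegree 𝒜 0).toSubalgebra
    (tmul_mem_formsDegree (zero_add 0) SetLike.GradedOne.one_mem SetLike.GradedOne.one_mem)
    (by
      intro x y hx hy
      induction hx using Submodule.span_induction with
      | zero => rw [zero_mul]; exact zero_mem _
      | add x x' _ _ hx hx' => rw [add_mul]; exact add_mem hx hx'
      | smul c x _ hx => rw [forms_smul_mul]; exact Submodule.smul_mem _ c hx
      | mem x hx =>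
        obtain ⟨i, j, hij, a, ha, ω, hω, rfl⟩ := hx
        induction hy using Submodule.span_induction with
        | zero => rw [mul_zero]; exact zero_mem _
        | add y y' _ _ hy hy' => rw [mul_add]; exact add_mem hy hy'
        | smul c y _ hy => rw [forms_mul_smul]; exact Submodule.smul_mem _ c hy
        | mem y hy =>
          obtain ⟨k, l, hkl, b, hb, τ, hτ, rfl⟩ := hy
          rw [forms_tmul_mul a hω hb]
          exact Submodule.smul_mem _ _ (tmul_mem_formsDegree (by omega)
            (SetLike.mul_mem_graded ha hb) (SetLike.mul_mem_graded hω hτ)))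

theorem formsDegree_zero_induction {p : FormsIn 𝒜 → Prop} (h0 : p 0)
    (hadd : ∀ x y, p x → p y → p (x + y)) (hsmul : ∀ (c : ℂ) x, p x → p (c • x))
    (h : ∀ (i j : ℤ) (a : A) (ω : DualNumber ℂ[X]), i + j = 0 → a ∈ 𝒜 i → ω ∈ dualGrading 1 j →
      p (tmul ℂ a ω)) {z : FormsIn 𝒜} (hz : z ∈ formsZero 𝒜) : p z := by
  replace hz : z ∈ formsDegree 𝒜 0 := hz
  induction hz using Submodule.span_induction with
  | zero => exact h0
  | add x y _ _ hx hy => exact hadd x y hx hy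
  | smul c x _ hx => exact hsmul c x hx
  | mem x hx =>
    obtain ⟨i, j, hij, a, ha, ω, hω, rfl⟩ := hx
    exact h i j a ω hij ha hω

/-- Elements `a ⊗ ω` and `b ⊗ τ` of total degree zero commute if `a` and `b` commute up to the
Koszul sign. -/
theorem forms_tmul_commute {i j k l : ℤ} (hij : i + j = 0) (hkl : k + l = 0) {a b : A}
    (ha : a ∈ 𝒜 i) (hb : b ∈ 𝒜 k) (hab : a * b = (-1 : ℂ) ^ (i * k) • (b * a))
    {ω τ : DualNumber ℂ[X]} (hω : ω ∈ dualGrading 1 j) (hτ : τ ∈ dualGrading 1 l) :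
    Commute (tmul ℂ a ω : FormsIn 𝒜) (tmul ℂ b τ) := by
  obtain rfl : i = -j := by omega
  obtain rfl : k = -l := by omega
  rw [Commute, SemiconjBy, forms_tmul_mul a hω hb, forms_tmul_mul b hτ ha, hab,
    GradedCommutative.mul_swap j l ω τ hω hτ, forms_tmul_smul, forms_tmul_smul_right, smul_smul,
    smul_smul, neg_one_zpow_mul, neg_one_zpow_mul]
  congr 1
  exact neg_one_zpow_eq ⟨j * l, by ring⟩

/-- Total degree zero allows odd tensor factors, such as those of `h(r) dt`; the sign from the first
factors is compensated by the sign from the forms. -/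
theorem formsι_commute {x y : FormsIn 𝒜} (hx : x ∈ formsZero 𝒜) (hy : y ∈ formsZero 𝒜) :
    Commute (formsι 𝒜 x) (formsι 𝒜 y) := by
  refine formsDegree_zero_induction (p := fun x => Commute (formsι 𝒜 x) (formsι 𝒜 y))
    (by simp) (fun u v hu hv => ?_) (fun c u hu => ?_)
    (fun i j a ω hij ha hω => ?_) hx
  · rw [map_add]; exact hu.add_left hv
  · rw [map_smul]; exact hu.smul_left c
  refine formsDegree_zero_induction (p := fun y => Commute (formsι 𝒜 (tmul ℂ a ω)) (formsι 𝒜 y))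
    (by simp) (fun u v hu hv => ?_) (fun c u hu => ?_)
    (fun k l b τ hkl hb hτ => ?_) hy
  · rw [map_add]; exact hu.add_right hv
  · rw [map_smul]; exact hu.smul_right c
  exact forms_tmul_commute hij hkl (Sym.ι_mem ha) (Sym.ι_mem hb) (Sym.ι_swap ha hb) hω hτ

/-- The differential `d ⊗ 1 + 1 ⊗ d_dR` on `A ⊗ ℂ[t, dt]`. -/
def formsBaseDiff (d : A →ₗ[ℂ] A) : FormsIn 𝒜 →ₗ[ℂ] FormsIn 𝒜 :=
  (GradedTensorProduct.of ℂ 𝒜 (dualGrading 1)).toLinearMap ∘ₗ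
    (TensorProduct.map d LinearMap.id +
      TensorProduct.map (signTwist 𝒜 1) deRham) ∘ₗ
    (GradedTensorProduct.of ℂ 𝒜 (dualGrading 1)).symm.toLinearMap

theorem formsBaseDiff_tmul (d : A →ₗ[ℂ] A) {i : ℤ} {a : A} (ha : a ∈ 𝒜 i)
    (ω : DualNumber ℂ[X]) :
    formsBaseDiff d (tmul ℂ a ω : FormsIn 𝒜) =
      tmul ℂ (d a) ω + (-1 : ℂ) ^ i • tmul ℂ a (deRham ω) := by
  rw [← forms_tmul_smul, ← mul_one i, ← signTwist_apply 1 ha]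
  rfl

theorem formsDiff_eq (Q : Sym 𝒜 →ₗ[ℂ] Sym 𝒜) :
    formsDiff Q = formsBaseDiff (𝒜 := Sym.grading 𝒜) Q := rfl

theorem deRham_mul {j : ℤ} {ω : DualNumber ℂ[X]} (hω : ω ∈ dualGrading 1 j)
    (τ : DualNumber ℂ[X]) : deRham (ω * τ) = deRham ω * τ + (-1 : ℂ) ^ j • (ω * deRham τ) := by
  by_cases hj : j = 0
  · subst hj
    refine TrivSqZeroExt.ext (by simp [deRham]) ?_
    simp [deRham, Polynomial.derivative_mul]
    ring
  · have h : ω.fst = 0 := hω.1 hj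
    refine TrivSqZeroExt.ext (by simp [deRham]) ?_
    simp [deRham, h]

theorem deRham_mem {j : ℤ} {ω : DualNumber ℂ[X]} (hω : ω ∈ dualGrading 1 j) :
    deRham ω ∈ dualGrading 1 (j + 1) := by
  refine ⟨fun _ => by simp [deRham], fun h => ?_⟩
  simp [deRham, hω.1 (fun hj => h (by omega))]

/-- The Leibniz rule has no sign because the left factor has total degree zero. -/
theorem formsDiff_formsι_mul (d : A →ₗ[ℂ] A) (hd : ∀ i, ∀ a ∈ 𝒜 i, d a ∈ 𝒜 (i + 1))
    {z : FormsIn 𝒜} (hz : z ∈ formsZero 𝒜) (w : FormsIn (Sym.grading 𝒜)) :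
    formsDiff (Sym.derivation d 1 hd) (formsι 𝒜 z * w) =
      formsι 𝒜 (formsBaseDiff d z) * w + formsι 𝒜 z * formsDiff (Sym.derivation d 1 hd) w := by
  rw [formsDiff_eq]
  refine formsDegree_zero_induction (p := fun z =>
    formsBaseDiff (Sym.derivation d 1 hd) (formsι 𝒜 z * w) =
      formsι 𝒜 (formsBaseDiff d z) * w +
        formsι 𝒜 z * formsBaseDiff (𝒜 := Sym.grading 𝒜) (Sym.derivation d 1 hd) w)
    (by simp) (fun x y hx hy => ?_) (fun c x hx => ?_)
    (fun i j a ω hij ha hω => ?_) hz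
  · simp only [map_add, add_mul, hx, hy]; abel
  · simp only [map_smul, forms_smul_mul, hx, smul_add]
  obtain rfl : i = -j := by omega
  have h : formsBaseDiff (Sym.derivation d 1 hd) ∘ₗ formsMul (formsι 𝒜 (tmul ℂ a ω)) =
      formsMul (formsι 𝒜 (formsBaseDiff d (tmul ℂ a ω))) +
        formsMul (formsι 𝒜 (tmul ℂ a ω)) ∘ₗ
          formsBaseDiff (𝒜 := Sym.grading 𝒜) (Sym.derivation d 1 hd) := by
    refine forms_hom_ext fun m u hu τ => ?_
    have hau := SetLike.mul_mem_graded (Sym.ι_mem ha) hu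
    have hdu := derivation_mem_grading d 1 hd hu
    simp only [LinearMap.comp_apply, LinearMap.add_apply, formsMul_apply, formsι_tmul,
      formsBaseDiff_tmul d ha, map_add, map_smul, add_mul, mul_add, smul_mul_assoc,
      forms_tmul_mul _ hω hu, forms_tmul_mul _ (deRham_mem hω) hu, formsBaseDiff_tmul _ hau,
      formsBaseDiff_tmul _ hu, forms_tmul_mul _ hω hdu, Sym.derivation_mul, signTwist_apply 1 ha,
      deRham_mul hω, forms_tmul_add, forms_add_tmul, forms_tmul_smul, forms_tmul_smul_right,
      smul_add, smul_smul, neg_one_zpow_mul]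
    -- Passing the derivation over `a` costs `(-1)^(-j)`; passing `ω` over the derivative of `u`
    -- instead of `u` costs an additional `(-1)^j`. These agree, and the other exponents differ only
    -- in form.
    rw [neg_one_zpow_eq (m := j * m + -j * 1) (n := j * m + j * 1) ⟨-j, by ring⟩,
      neg_one_zpow_eq (m := j * m + (-j + m)) (n := -j + (j * m + 1 * m)) ⟨0, by ring⟩,
      neg_one_zpow_eq (m := j * m + (-j + m + j)) (n := m + j * m) ⟨0, by ring⟩]
    abel
  exact LinearMap.congr_fun h w

theorem formsDiff_one (d : A →ₗ[ℂ] A) (hd : ∀ i, ∀ a ∈ 𝒜 i, d a ∈ 𝒜 (i + 1)) :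
    formsDiff (Sym.derivation d 1 hd) 1 = 0 := by
  rw [formsDiff_eq]
  change formsBaseDiff _ (tmul ℂ 1 1 : FormsIn (Sym.grading 𝒜)) = 0
  rw [formsBaseDiff_tmul _ (SetLike.GradedOne.one_mem (A := Sym.grading 𝒜)), Sym.derivation_one]
  have : deRham (1 : DualNumber ℂ[X]) = 0 := by simp [deRham]
  rw [this]
  simp [tmul]

theorem formsDiff_coalgebraExtension (d : A →ₗ[ℂ] A) (hd : ∀ i, ∀ a ∈ 𝒜 i, d a ∈ 𝒜 (i + 1))
    {Z : ℕ → FormsIn 𝒜} (hZ : ∀ k, Z k ∈ formsZero 𝒜) (hdZ : ∀ k, 1 ≤ k → formsBaseDiff d (Z k) = 0)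
    (n : ℕ) :
    formsDiff (Sym.derivation d 1 hd) (coalgebraExtension (fun k => formsι 𝒜 (Z k)) n) = 0 := by
  rw [coalgebraExtension, map_sum]
  refine Finset.sum_eq_zero fun π _ => ?_
  have h (l : List ℕ) (hl : ∀ k ∈ l, 1 ≤ k) : formsDiff (Sym.derivation d 1 hd)
      (l.map fun k => formsι 𝒜 (Z k)).prod = 0 := by
    induction l with
    | nil => simpa using formsDiff_one d hd
    | cons k l ih =>
      rw [List.map_cons, List.prod_cons, formsDiff_formsι_mul d hd (hZ k), hdZ k (hl k (by simp)),
        ih fun j hj => hl j (by simp [hj])]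
      simp
  have := h (List.ofFn π.partSize) (by
    intro k hk
    obtain ⟨i, rfl⟩ := List.mem_ofFn.1 hk
    exact π.partSize_pos i)
  rwa [List.map_ofFn] at this

variable [GradedCommutative 𝒜]

theorem formsZero_commute {x y : FormsIn 𝒜} (hx : x ∈ formsZero 𝒜) (hy : y ∈ formsZero 𝒜) :
    Commute x y := by
  refine formsDegree_zero_induction (p := fun x => Commute x y) (by simp)
    (fun u v hu hv => hu.add_left hv)
    (fun c u hu => hu.smul_left c) (fun i j a ω hij ha hω => ?_) hx
  refine formsDegree_zero_induction (p := fun y => Commute (tmul ℂ a ω) y) (by simp)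
    (fun u v hu hv => hu.add_right hv)
    (fun c u hu => hu.smul_right c) (fun k l b τ hkl hb hτ => ?_) hy
  exact forms_tmul_commute hij hkl ha hb (GradedCommutative.mul_swap i k a b ha hb) hω hτ

/-- Multiplication by an element `a` of total degree zero extends to a derivation `δ` of
`S A ⊗ ℂ[t, dt]`, and `φ ⊗ 1` intertwines the product with `a` and `a ⊙ · + δ`. -/
theorem exists_formsJoin {a : FormsIn 𝒜} (ha : a ∈ formsZero 𝒜) :
    ∃ δ : FormsIn (Sym.grading 𝒜) →ₗ[ℂ] FormsIn (Sym.grading 𝒜), δ 1 = 0 ∧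
      (∀ z ∈ formsZero 𝒜, ∀ w, δ (formsι 𝒜 z * w) = formsι 𝒜 (a * z) * w + formsι 𝒜 z * δ w) ∧
      ∀ w, formsMap (cumulantHom 𝒜) (formsι 𝒜 a * w) =
        formsι 𝒜 a * formsMap (cumulantHom 𝒜) w + δ (formsMap (cumulantHom 𝒜) w) := by
  refine formsDegree_zero_induction (p := fun a : FormsIn 𝒜 =>
    ∃ δ : FormsIn (Sym.grading 𝒜) →ₗ[ℂ] FormsIn (Sym.grading 𝒜), δ 1 = 0 ∧
      (∀ z ∈ formsZero 𝒜, ∀ w, δ (formsι 𝒜 z * w) = formsι 𝒜 (a * z) * w + formsι 𝒜 z * δ w) ∧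
      ∀ w, formsMap (cumulantHom 𝒜) (formsι 𝒜 a * w) =
        formsι 𝒜 a * formsMap (cumulantHom 𝒜) w + δ (formsMap (cumulantHom 𝒜) w))
    ⟨0, by simp⟩ ?_ ?_ (fun i j a ω hij ha hω => ?_) ha
  · rintro x y ⟨δ, h1, h2, h3⟩ ⟨ε, h1', h2', h3'⟩
    refine ⟨δ + ε, by simp [h1, h1'], fun z hz w => ?_, fun w => ?_⟩
    · simp only [LinearMap.add_apply, h2 z hz, h2' z hz, add_mul, map_add, mul_add]; abel
    · simp only [LinearMap.add_apply, map_add, add_mul, h3, h3']; abel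
  · rintro c x ⟨δ, h1, h2, h3⟩
    refine ⟨c • δ, by simp [h1], fun z hz w => ?_, fun w => ?_⟩
    · simp only [LinearMap.smul_apply, h2 z hz, forms_smul_mul, map_smul, forms_mul_smul, smul_add]
    · simp only [LinearMap.smul_apply, map_smul, forms_smul_mul, h3, smul_add]
  obtain rfl : i = -j := by omega
  let Da := Sym.derivation (LinearMap.mulLeft ℂ a) (-j) (mulLeft_degree 𝒜 ha)
  have hDa {m : ℤ} {u : Sym 𝒜} (hu : u ∈ Sym.grading 𝒜 m) : Da u ∈ Sym.grading 𝒜 (m + -j) :=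
    derivation_mem_grading _ _ _ hu
  -- Moving `ω` past `Da u`, of degree `m - j`, gives the exponent `j * (m - j)`. The prefactor
  -- `(-1)^j` removes the excess `j²`, leaving the sign `(-1)^(j * m)` of moving `ω` past `u`.
  let δ : FormsIn (Sym.grading 𝒜) →ₗ[ℂ] FormsIn (Sym.grading 𝒜) :=
    (-1 : ℂ) ^ j • (formsMul (tmul ℂ 1 ω) ∘ₗ formsMap Da)
  have hδ {m : ℤ} {u : Sym 𝒜} (hu : u ∈ Sym.grading 𝒜 m) (τ : DualNumber ℂ[X]) :
      δ (tmul ℂ u τ) = (-1 : ℂ) ^ (j * m) • tmul ℂ (Da u) (ω * τ) := by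
    simp only [δ, LinearMap.smul_apply, LinearMap.comp_apply, formsMap_tmul,
      formsMul_apply, forms_tmul_mul _ hω (hDa hu), one_mul, smul_smul, neg_one_zpow_mul]
    congr 1
    rcases Int.even_or_odd j with ⟨k, hk⟩ | ⟨k, hk⟩
    · exact neg_one_zpow_eq ⟨k - j * k, by rw [hk]; ring⟩
    · exact neg_one_zpow_eq ⟨-j * k, by rw [hk]; ring⟩
  refine ⟨δ, ?_, fun z hz w => ?_, fun w => ?_⟩
  · have h := hδ (SetLike.GradedOne.one_mem (A := Sym.grading 𝒜)) 1
    rw [show Da 1 = 0 from Sym.derivation_one _ _ _] at h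
    change δ (tmul ℂ 1 1) = 0
    rw [h]
    simp [tmul]
  · refine formsDegree_zero_induction (p := fun z => δ (formsι 𝒜 z * w) =
        formsι 𝒜 (tmul ℂ a ω * z) * w + formsι 𝒜 z * δ w)
      (by simp) (fun x y hx hy => ?_) (fun c x hx => ?_)
      (fun k l b σ hkl hb hσ => ?_) hz
    · simp only [map_add, add_mul, mul_add, hx, hy]; abel
    · simp only [map_smul, smul_mul_assoc, forms_mul_smul, hx, smul_add]
    obtain rfl : k = -l := by omega
    have h : δ ∘ₗ formsMul (formsι 𝒜 (tmul ℂ b σ)) =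
        formsMul (formsι 𝒜 (tmul ℂ a ω * tmul ℂ b σ)) +
          formsMul (formsι 𝒜 (tmul ℂ b σ)) ∘ₗ δ := by
      refine forms_hom_ext fun m u hu τ => ?_
      have hbu := SetLike.mul_mem_graded (Sym.ι_mem hb) hu
      have hD : Da (Sym.ι 𝒜 b * u) =
          Sym.ι 𝒜 (a * b) * u + (-1 : ℂ) ^ (-l * -j) • (Sym.ι 𝒜 b * Da u) := by
        simp only [Da, Sym.derivation_mul, signTwist_apply _ hb, map_smul, smul_mul_assoc,
          LinearMap.mulLeft_apply]
      have hsw : σ * (ω * τ) = (-1 : ℂ) ^ (l * j) • (ω * (σ * τ)) := by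
        rw [← mul_assoc, GradedCommutative.mul_swap l j σ ω hσ hω, smul_mul_assoc, mul_assoc]
      simp only [LinearMap.comp_apply, LinearMap.add_apply, formsMul_apply, formsι_tmul,
        forms_tmul_mul _ hω hb, map_smul, smul_mul_assoc, forms_tmul_mul _ hσ hu,
        hδ hbu, hδ hu, forms_tmul_mul _ (SetLike.mul_mem_graded hω hσ) hu,
        forms_tmul_mul _ hσ (hDa hu), hD, hsw, forms_add_tmul, forms_tmul_smul,
        forms_tmul_smul_right, smul_add, smul_smul, neg_one_zpow_mul, mul_assoc]
      congr 2
      · exact neg_one_zpow_eq ⟨0, by ring⟩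
      · exact neg_one_zpow_eq ⟨0, by ring⟩
    exact LinearMap.congr_fun h w
  · have h : formsMap (cumulantHom 𝒜) ∘ₗ formsMul (formsι 𝒜 (tmul ℂ a ω)) =
        formsMul (formsι 𝒜 (tmul ℂ a ω)) ∘ₗ formsMap (cumulantHom 𝒜) +
          δ ∘ₗ formsMap (cumulantHom 𝒜) := by
      refine forms_hom_ext fun m u hu τ => ?_
      have hφu := cumulantHom_mem_grading hu
      simp only [LinearMap.comp_apply, LinearMap.add_apply, formsMul_apply, formsι_tmul,
        forms_tmul_mul _ hω hu, map_smul, formsMap_tmul, forms_tmul_mul _ hω hφu, hδ hφu,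
        cumulantHom_mul, join_apply ha, forms_add_tmul, smul_add]
      rfl
    exact LinearMap.congr_fun h w

theorem formsMap_cumulantHom_coalgebraExtension {Z : ℕ → FormsIn 𝒜}
    (hZ : ∀ k, 1 ≤ k → Z k ∈ formsZero 𝒜) (n : ℕ) :
    formsMap (cumulantHom 𝒜) (coalgebraExtension (fun k => formsι 𝒜 (Z k)) n) =
      coalgebraExtension (fun k => formsι 𝒜 (coalgebraExtension Z k)) n :=
  map_coalgebraExtension_eq_moments (formsZero 𝒜) (formsι 𝒜)
    (fun _ hx _ hy => formsZero_commute hx hy) (fun _ hx _ hy => formsι_commute hx hy)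
    (formsMap (cumulantHom 𝒜)) (formsMap_one (cumulantHom_one 𝒜))
    (fun _ ha => exists_formsJoin ha) hZ n

theorem formsMap_cumulantHom_injective :
    Function.Injective (formsMap (cumulantHom 𝒜) :
      FormsIn (Sym.grading 𝒜) →ₗ[ℂ] FormsIn (Sym.grading 𝒜)) := by
  refine Function.LeftInverse.injective (g := formsMap (cumulantMap 𝒜).symm.toLinearMap) ?_
  intro w
  have h : formsMap (cumulantMap 𝒜).symm.toLinearMap ∘ₗ formsMap (cumulantHom 𝒜) =
      (LinearMap.id : FormsIn (Sym.grading 𝒜) →ₗ[ℂ] FormsIn (Sym.grading 𝒜)) :=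
    forms_hom_ext fun m u hu τ => by
      rw [LinearMap.comp_apply, formsMap_tmul, formsMap_tmul]
      exact congrArg (tmul ℂ · τ) ((cumulantMap 𝒜).symm_apply_apply u)
  exact LinearMap.congr_fun h w

/-- `φ ⊗ 1` intertwines the differentials of `d^φ` and `d`. -/
theorem formsMap_formsDiff (d : A →ₗ[ℂ] A) (hd : ∀ i, ∀ a ∈ 𝒜 i, d a ∈ 𝒜 (i + 1))
    (w : FormsIn (Sym.grading 𝒜)) :
    formsMap (cumulantHom 𝒜) (formsDiff (transported d hd) w) =
      formsDiff (Sym.derivation d 1 hd) (formsMap (cumulantHom 𝒜) w) := by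
  have h : formsMap (cumulantHom 𝒜) ∘ₗ formsDiff (transported d hd) =
      formsDiff (Sym.derivation d 1 hd) ∘ₗ formsMap (cumulantHom 𝒜) := by
    refine forms_hom_ext fun m u hu τ => ?_
    have ht : cumulantHom 𝒜 (transported d hd u) = Sym.derivation d 1 hd (cumulantHom 𝒜 u) :=
      (cumulantMap 𝒜).apply_symm_apply _
    simp only [LinearMap.comp_apply, formsDiff_eq, formsBaseDiff_tmul _ hu, formsMap_tmul,
      formsBaseDiff_tmul _ (cumulantHom_mem_grading hu), map_add, map_smul, ht]
  exact LinearMap.congr_fun h w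

/-- Closedness may be tested after the injective map `φ ⊗ 1`, which replaces `d^φ` by `d` and the
cumulants of `Z` by `Z` itself. -/
theorem formsDiff_transported_coalgebraExtension (d : A →ₗ[ℂ] A)
    (hd : ∀ i, ∀ a ∈ 𝒜 i, d a ∈ 𝒜 (i + 1)) {Z : ℕ → FormsIn 𝒜} (hZ : ∀ k, Z k ∈ formsZero 𝒜)
    (hdZ : ∀ k, 1 ≤ k → formsBaseDiff d (Z k) = 0) (n : ℕ) :
    formsDiff (transported d hd)
      (coalgebraExtension (fun k => formsι 𝒜 (partitionSum cumulantCoeff Z k)) n) = 0 := by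
  have hc (k : ℕ) : partitionSum cumulantCoeff Z k ∈ formsZero 𝒜 :=
    Subalgebra.sum_mem _ fun π _ => Subalgebra.smul_mem _ (Subalgebra.list_prod_mem _ fun x hx => by
      obtain ⟨i, rfl⟩ := List.mem_ofFn.1 hx
      exact hZ _) _
  apply formsMap_cumulantHom_injective
  rw [formsMap_formsDiff, formsMap_cumulantHom_coalgebraExtension fun k _ => hc k, map_zero,
    ← formsDiff_coalgebraExtension d hd hZ hdZ n]
  congr 1
  exact coalgebraExtension_congr (fun k hk => by
    rw [moment_cumulant (fun i j _ _ => formsZero_commute (hZ i) (hZ j)) hk]) n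

end Forms

/-! ### Evaluation of forms at a point -/

section Evaluation

open GradedTensorProduct

variable {A : Type} [Ring A] [Algebra ℂ A] (𝒜 : ℤ → Submodule ℂ A) [GradedAlgebra 𝒜]

/-- The evaluation at `t = s`, `dt = 0` is an algebra map. -/
theorem exists_evalForms_algHom (s : ℂ) :
    ∃ F : FormsIn 𝒜 →ₐ[ℂ] A, ∀ z, F z = evalForms 𝒜 s z := by
  let g : DualNumber ℂ[X] →ₐ[ℂ] A := (Algebra.ofId ℂ A).comp
    ((Polynomial.aeval s).comp (TrivSqZeroExt.fstHom ℂ ℂ[X] ℂ[X]))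
  have hg (ω : DualNumber ℂ[X]) : g ω = algebraMap ℂ A (ω.fst.eval s) := by
    simp [g, Algebra.ofId_apply, Polynomial.coe_aeval_eq_eval]
  -- The two algebra maps have to commute up to Koszul sign: forms of degree zero evaluate to
  -- central scalars, and all others evaluate to zero.
  let F : FormsIn 𝒜 →ₐ[ℂ] A := GradedTensorProduct.lift 𝒜 (dualGrading 1) (AlgHom.id ℂ A) g (by
    intro i j a b
    by_cases hj : j = 0
    · subst hj
      rw [zero_mul, uzpow_zero, one_smul, hg]
      exact (Algebra.commutes _ _).symm
    · have : (b : DualNumber ℂ[X]).fst = 0 := b.2.1 hj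
      simp [hg, this])
  refine ⟨F, fun z => ?_⟩
  have h : F.toLinearMap = evalForms 𝒜 s := forms_hom_ext fun i a _ τ => by
    have h1 : F (tmul ℂ a τ) = a * g τ := rfl
    have h2 : evalForms 𝒜 s (tmul ℂ a τ) = τ.fst.eval s • a := rfl
    rw [AlgHom.toLinearMap_apply, h1, h2, hg, Algebra.smul_def, Algebra.commutes]
  exact LinearMap.congr_fun h z

end Evaluation

/-! ### Closedness and endpoints of the Gaussian homotopy -/

section Gaussian

open Polynomial GradedTensorProduct

theorem gaussHomotopy_eq (p q : ℂ[X]) :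
    gaussHomotopy p q = partitionSum cumulantCoeff (gaussLambda p q) := rfl

theorem gaussH_mem (r : ℂ[X]) : gaussH r ∈ gaussGrading (-1) :=
  Submodule.sum_mem _ fun i _ => Submodule.smul_mem _ _ (Submodule.neg_mem _
    ⟨fun _ => by simp, fun h => absurd rfl h⟩)

theorem gaussLambda_mem (p q : ℂ[X]) (n : ℕ) : gaussLambda p q n ∈ formsZero gaussGrading := by
  refine add_mem (add_mem ?_ ?_) ?_
  · exact tmul_mem_formsDegree (zero_add 0) (inl_mem_gaussGrading _) SetLike.GradedOne.one_mem
  · exact tmul_mem_formsDegree (zero_add 0) (inl_mem_gaussGrading _)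
      ⟨fun h => absurd rfl h, fun _ => by simp⟩
  · exact tmul_mem_formsDegree (by norm_num) (gaussH_mem _)
      ⟨fun _ => by simp, fun h => absurd rfl h⟩

theorem diff_inl (r : ℂ[X]) : diff (TrivSqZeroExt.inl r) = 0 := by simp [diff]

/-- Only two terms survive, `(qⁿ - pⁿ) ⊗ dt` from `d_dR t` and `(pⁿ - qⁿ) ⊗ dt` from `d h`. The
equality of moments is what makes `h(pⁿ - qⁿ)` a primitive. -/
theorem formsBaseDiff_gaussLambda {p q : ℂ[X]} {n : ℕ}
    (h : expectation (TrivSqZeroExt.inl (p ^ n)) = expectation (TrivSqZeroExt.inl (q ^ n))) :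
    formsBaseDiff diff (gaussLambda p q n) = 0 := by
  have h1 : deRham (1 : DualNumber ℂ[X]) = 0 := by simp [deRham]
  have h2 : deRham (TrivSqZeroExt.inl X) = DualNumber.eps :=
    congrArg TrivSqZeroExt.inr derivative_X
  have h3 : deRham (DualNumber.eps : DualNumber ℂ[X]) = 0 := by simp [deRham]
  have h4 : diff (gaussH (p ^ n - q ^ n)) = TrivSqZeroExt.inl (p ^ n - q ^ n) :=
    diff_gaussH (by rw [TrivSqZeroExt.inl_sub, map_sub, h, sub_self])
  have h0 (ω : DualNumber ℂ[X]) : (tmul ℂ (0 : GaussV) ω : FormsIn gaussGrading) = 0 := by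
    rw [← zero_smul ℂ (0 : GaussV), forms_tmul_smul, zero_smul]
  have h0' (a : GaussV) : (tmul ℂ a (0 : DualNumber ℂ[X]) : FormsIn gaussGrading) = 0 := by
    rw [← zero_smul ℂ (0 : DualNumber ℂ[X]), forms_tmul_smul_right, zero_smul]
  rw [gaussLambda, map_add, map_add, formsBaseDiff_tmul _ (inl_mem_gaussGrading _),
    formsBaseDiff_tmul _ (inl_mem_gaussGrading _), formsBaseDiff_tmul _ (gaussH_mem _), diff_inl,
    diff_inl, h1, h2, h3, h4, h0, h0, h0', h0', smul_zero, smul_zero, add_zero, zero_add, add_zero,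
    zpow_zero, one_smul, zero_add, ← forms_add_tmul, ← TrivSqZeroExt.inl_add, sub_add_sub_cancel,
    sub_self, TrivSqZeroExt.inl_zero, h0]

theorem evalForms_gaussLambda (p q : ℂ[X]) (s : ℂ) (n : ℕ) :
    evalForms gaussGrading s (gaussLambda p q n) =
      TrivSqZeroExt.inl (p ^ n) + s • TrivSqZeroExt.inl (q ^ n - p ^ n) := by
  have h (a : GaussV) (τ : DualNumber ℂ[X]) :
      evalForms gaussGrading s (tmul ℂ a τ) = τ.fst.eval s • a := rfl
  rw [gaussLambda, map_add, map_add, h, h, h]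
  simp

/-- Evaluation is multiplicative, so it commutes with the partition sum. What remains are the
cumulants of the sequence `r ^ k`, which is the moment sequence of the ordinary variable `r`. -/
theorem evalForms_gaussHomotopy {p q r : ℂ[X]} {s : ℂ}
    (h : ∀ n, 1 ≤ n → evalForms gaussGrading s (gaussLambda p q n) = TrivSqZeroExt.inl (r ^ n))
    {n : ℕ} (hn : 1 ≤ n) :
    evalForms gaussGrading s (gaussHomotopy p q n) = ordinaryVariable r n := by
  obtain ⟨F, hF⟩ := exists_evalForms_algHom gaussGrading s
  rw [gaussHomotopy_eq, ← hF, map_partitionSum,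
    ← cumulant_moment (f := ordinaryVariable r) (fun _ _ _ _ => Commute.all _ _) hn]
  exact partitionSum_congr _ (fun k hk => by
    rw [hF, h k hk, coalgebraExtension_ordinaryVariable]) n

end Gaussian

end HomotopyProbability

end

theorem mainTheorem4 (p q : Polynomial ℂ)
    (hκ : ∀ n : ℕ, 1 ≤ n →
      HomotopyProbability.gaussCumulant (HomotopyProbability.ordinaryVariable p) n =
        HomotopyProbability.gaussCumulant (HomotopyProbability.ordinaryVariable q) n) :
    HomotopyProbability.IsLInfHomotopy HomotopyProbability.gaussTransported
      (HomotopyProbability.ordinaryVariable p) (HomotopyProbability.ordinaryVariable q)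
      (HomotopyProbability.gaussHomotopy p q) := by
  open HomotopyProbability in
  exact {
    left := isLInfMorphism_ordinaryVariable p
    right := isLInfMorphism_ordinaryVariable q
    degree_zero := fun n _ => Subalgebra.sum_mem (formsZero gaussGrading) fun π _ =>
      Subalgebra.smul_mem _ (Subalgebra.list_prod_mem _ fun x hx => by
        obtain ⟨i, rfl⟩ := List.mem_ofFn.1 hx
        exact gaussLambda_mem p q _) _
    closed := fun n _ => formsDiff_transported_coalgebraExtension diff diff_degree
      (gaussLambda_mem p q)
      (fun k hk => formsBaseDiff_gaussLambda (expectation_pow_eq_of_cumulants hκ hk)) n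
    eval_zero := fun n hn => evalForms_gaussHomotopy (fun k _ => by
      rw [evalForms_gaussLambda, zero_smul, add_zero]) hn
    eval_one := fun n hn => evalForms_gaussHomotopy (fun k _ => by
      rw [evalForms_gaussLambda, one_smul, ← TrivSqZeroExt.inl_add, add_sub_cancel]) hn }
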